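/- Let $(\mathcal S,\mathcal A,P,r)$ be a Markov decision process with finite nonempty state space $\mathcal S$ and action space $\mathcal A$, transition kernel $P:\mathcal S\times\mathcal A\to\Delta(\mathcal S)$ and rewards $r\in[0,1]^{\mathcal S\times\mathcal A}$; no communication assumption is made. Write $P_{sa}v=\sum_{s'}P(s'\mid s,a)v(s')$ for $v\in\mathbb R^{\mathcal S}$. A policy is a map $\pi:\mathcal S\to\Delta(\mathcal A)$, and $\mathbb E_s^\pi$ is the expectation over trajectories with $S_0=s$, $A_t\sim\pi(S_t)$, $S_{t+1}\sim P(\cdot\mid S_t,A_t)$. Put $R_t=r(S_t,A_t)$ and define $$\rho^\pi(s)=\lim_{T\to\infty}\frac1T\,\mathbb E_s^\pi\Big[\sum_{t=0}^{T-1}R_t\Big],\qquad \rho^\star=\sup_\pi\rho^\pi\ \text{(elementwise)},\qquad h^\pi(s)=\operatorname*{C-lim}_{T\to\infty}\mathbb E_s^\pi\Big[\sum_{t=0}^{T-1}\big(R_t-\rho^\pi(S_t)\big)\Big],$$ where $\operatorname{C-lim}$ is the Cesàro limit. For $\gamma\in[0,1)$ let $V_\gamma^\pi(s)=\mathbb E_s^\pi[\sum_{t\ge0}\gamma^tR_t]$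 and $V_\gamma^\star=\sup_\pi V_\gamma^\pi$ (elementwise). Let $\pi^\star$ be a Blackwell-optimal policy: there is $\overline\gamma<1$ such that $V_\gamma^{\pi^\star}=V_\gamma^\star$ for all $\gamma\in[0,1)$ with $\gamma\ge\overline\gamma$. For $v\in\mathbb R^{\mathcal S}$ let $\mathrm{sp}(v)=\max_s v(s)-\min_s v(s)$. Let $$\mathsf T_{\mathrm{drop}}=\max_{\pi:\mathcal S\to\mathcal A}\ \max_{s\in\mathcal S}\ \mathbb E_s^\pi\Big[\sum_{t=0}^\infty\mathbb I\big(P_{S_tA_t}\rho^\star<\rho^\star(S_t)\big)\Big]$$ be the gain-dropping time (the first maximum is over deterministic policies), a finite number. For $\gamma\in[0,1]$ let $\mathcal T_\gamma(V)(s)=\max_{a}\{r(s,a)+\gamma P_{sa}V\}$ and $\mathcal T=\mathcal T_1$. **Algorithm (Warm-Start Halpern-Then-Picard)** with discount factor $\gamma\in[0,1)$ and $N\ge E':=\lfloor\frac1{1-\gamma}\rfloor$ iterations. Put $E=E'-1$ and $y_0=\mathcal T^{(E')}(\mathbf 0)$ (that is, $E'$ undiscounted value iterations started at $\mathbf 0$).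 For $t\ge0$ put $$y_{t+1}=\begin{cases}(1-\beta_{t+1})\,y_0+\beta_{t+1}\,\mathcal T_\gamma(y_t), & t<E,\\ \mathcal T_\gamma(y_t), & t\ge E,\end{cases}\qquad \beta_t=1-\frac2{t+2}.$$ Return $V=y_{N-E'}$ and a deterministic policy $\widehat\pi$ with $\widehat\pi(s)\in\arg\max_{a}\{r(s,a)+\gamma P_{sa}V\}$ for all $s$, with ties broken arbitrarily. **Theorem.** Fix an integer $n\ge2$, set $\gamma=1-\frac1n$ and run the algorithm for $N=2n$ iterations. Let $h\in\mathbb R^{\mathcal S}$ be such that $(\rho^\star,h)$ satisfies both the modified and the unmodified multichain optimality equations, that is, for all $s\in\mathcal S$, $$\max_a P_{sa}\rho^\star=\rho^\star(s),\qquad \max_a\{r(s,a)+P_{sa}h\}=\rho^\star(s)+h(s),\qquad \max_{a:\,P_{sa}\rho^\star=\rho^\star(s)}\{r(s,a)+P_{sa}h\}=\rho^\star(s)+h(s).$$ Then the output policy $\widehat\pi$ satisfies, elementwise, $$\rho^\star-\rho^{\widehat\pi}\le(\mathsf T_{\mathrm{drop}}+1)\,\frac{71M+2}{n-1},\qquad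 M=\min\big\{\mathrm{sp}(h),\ \mathrm{sp}(h^{\pi^\star})+\mathsf T_{\mathrm{drop}}+\mathrm{sp}(h^{\pi^\star})\,\mathsf T_{\mathrm{drop}}\big\}.$$ -/

import Mathlib

open MeasureTheory ProbabilityTheory Filter Topology

/-- A finite Markov decision process: transition kernel `P : S × A → Δ(S)` and
reward function `r ∈ [0,1]^{S × A}`. -/
structure MDP (S A : Type*) where
  /-- `P s a` is the law of the next state when action `a` is taken in state `s`. -/
  P : S → A → PMF S
  /-- The reward function. -/
  r : S → A → ℝ
  r_mem : ∀ s a, r s a ∈ Set.Icc (0 : ℝ) 1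

namespace MDP

/-- Randomized Markovian (stationary) policies `S → Δ(A)`. -/
abbrev Policy (S A : Type*) := S → PMF A

/-- The policy induced by a deterministic decision rule. -/
noncomputable def detPolicy {S A : Type*} (d : S → A) : Policy S A := fun s => PMF.pure (d s)

/-- The span seminorm `max v - min v` on a nonempty finite set. -/
noncomputable def span {S : Type*} [Fintype S] [Nonempty S] (v : S → ℝ) : ℝ :=
  Finset.univ.sup' Finset.univ_nonempty v - Finset.univ.inf' Finset.univ_nonempty v

/-- The Cesàro limit of a real sequence, `lim_N (1/N) ∑_{T < N} a T`. -/
noncomputable def cesaroLim (a : ℕ → ℝ) : ℝ :=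
  limUnder atTop (fun N : ℕ => (1 / (N : ℝ)) * ∑ T ∈ Finset.range N, a T)

section Trajectories

variable {S A : Type*} [Fintype S] [MeasurableSpace S] [DiscreteMeasurableSpace S]
  [Fintype A] [MeasurableSpace A] [DiscreteMeasurableSpace A]

/-- The one-step kernel on state-action pairs under the policy `π`: from `(s, a)`, draw
`s' ∼ P(· | s, a)` and then `a' ∼ π(s')`. -/
noncomputable def stepKernel (M : MDP S A) (π : Policy S A) : Kernel (S × A) (S × A) :=
  Kernel.ofFunOfCountable fun x =>
    ((M.P x.1 x.2).bind fun s' => (π s').map fun a' => (s', a')).toMeasure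

instance (M : MDP S A) (π : Policy S A) : IsMarkovKernel (M.stepKernel π) :=
  ⟨fun _ => PMF.toMeasure.isProbabilityMeasure _⟩

/-- The law of the trajectory `((S_0, A_0), (S_1, A_1), …)` with `S_0 = s`, `A_t ∼ π(S_t)` and
`S_{t+1} ∼ P(· | S_t, A_t)`; expectation with respect to it is `𝔼_s^π`. -/
noncomputable def trajLaw (M : MDP S A) (π : Policy S A) (s : S) : Measure (ℕ → S × A) :=
  Kernel.trajMeasure (X := fun _ => S × A)
    ((π s).map fun a => (s, a)).toMeasure
    (fun n => (M.stepKernel π).comap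
      (fun ω : (i : Finset.Iic n) → S × A => ω ⟨n, Finset.mem_Iic.2 le_rfl⟩)
      (measurable_pi_apply _))

/-- The discounted value function `V_γ^π(s) = 𝔼_s^π[∑_t γ^t R_t]`. -/
noncomputable def value (M : MDP S A) (γ : ℝ) (π : Policy S A) (s : S) : ℝ :=
  ∫ ω, ∑' t : ℕ, γ ^ t * M.r (ω t).1 (ω t).2 ∂(M.trajLaw π s)

/-- The optimal discounted value function, an elementwise supremum over all policies. -/
noncomputable def optValue (M : MDP S A) (γ : ℝ) (s : S) : ℝ :=
  ⨆ π : Policy S A, M.value γ π s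

/-- The gain `ρ^π(s) = lim_T (1/T) 𝔼_s^π[∑_{t<T} R_t]`. -/
noncomputable def gain (M : MDP S A) (π : Policy S A) (s : S) : ℝ :=
  limUnder atTop (fun T : ℕ =>
    (1 / (T : ℝ)) * ∫ ω, ∑ t ∈ Finset.range T, M.r (ω t).1 (ω t).2 ∂(M.trajLaw π s))

/-- The optimal gain `ρ⋆`, an elementwise supremum over all policies. -/
noncomputable def optGain (M : MDP S A) (s : S) : ℝ :=
  ⨆ π : Policy S A, M.gain π s

/-- The bias `h^π(s)`, the Cesàro limit over `T` of `𝔼_s^π[∑_{t<T} (R_t - ρ^π(S_t))]`. -/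
noncomputable def bias (M : MDP S A) (π : Policy S A) (s : S) : ℝ :=
  cesaroLim (fun T : ℕ =>
    ∫ ω, ∑ t ∈ Finset.range T, (M.r (ω t).1 (ω t).2 - M.gain π (ω t).1) ∂(M.trajLaw π s))

/-- Blackwell optimality: discounted optimality for all discount factors close enough to `1`. -/
def IsBlackwellOptimal (M : MDP S A) (π : Policy S A) : Prop :=
  ∃ γ₀ : ℝ, γ₀ < 1 ∧ ∀ γ : ℝ, 0 ≤ γ → γ < 1 → γ₀ ≤ γ → ∀ s, M.value γ π s = M.optValue γ s

end Trajectories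

section Bellman

variable {S A : Type*} [Fintype S]

/-- `P_{sa} v = ∑_{s'} P(s' | s, a) v(s')`. -/
noncomputable def expNext (M : MDP S A) (s : S) (a : A) (v : S → ℝ) : ℝ :=
  ∑ s', (M.P s a s').toReal * v s'

/-- The Bellman operator `𝒯_γ(V)(s) = max_a (r(s,a) + γ P_{sa} V)`; the average-reward operator
`𝒯` is the case `γ = 1`. -/
noncomputable def bellman [Fintype A] [Nonempty A] (M : MDP S A) (γ : ℝ) (V : S → ℝ) : S → ℝ :=
  fun s => Finset.univ.sup' Finset.univ_nonempty fun a => M.r s a + γ * M.expNext s a V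

/-- The modified multichain optimality equations for `(ρ, h)`. -/
def ModifiedBellman (M : MDP S A) (ρ h : S → ℝ) : Prop :=
  (∀ s, IsGreatest {x | ∃ a, x = M.expNext s a ρ} (ρ s)) ∧
  (∀ s, IsGreatest {x | ∃ a, x = M.r s a + M.expNext s a h} (ρ s + h s))

/-- The (unmodified) multichain optimality equations for `(ρ, h)`. In the second one, the maximum
is over the actions with `P_{sa} ρ = ρ(s)` only. -/
def UnmodifiedBellman (M : MDP S A) (ρ h : S → ℝ) : Prop :=
  (∀ s, IsGreatest {x | ∃ a, x = M.expNext s a ρ} (ρ s)) ∧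
  (∀ s, IsGreatest {x | ∃ a, M.expNext s a ρ = ρ s ∧ x = M.r s a + M.expNext s a h}
    (ρ s + h s))

end Bellman

section GainDropping

open scoped ENNReal

variable {S A : Type*} [Fintype S] [MeasurableSpace S] [DiscreteMeasurableSpace S]
  [Fintype A] [MeasurableSpace A] [DiscreteMeasurableSpace A]

/-- The state-action pairs with `P_{sa} ρ⋆ < ρ⋆(s)`. -/
def gainDropping (M : MDP S A) : Set (S × A) :=
  {x | M.expNext x.1 x.2 M.optGain < M.optGain x.1}

/-- `T_drop^π`: the maximum over starting states of the expected number of times at which `π`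
takes a gain-dropping action. -/
noncomputable def policyDropTime (M : MDP S A) (π : Policy S A) : ℝ≥0∞ :=
  ⨆ s : S, ∫⁻ ω, ∑' t : ℕ, M.gainDropping.indicator (fun _ => (1 : ℝ≥0∞)) (ω t)
    ∂(M.trajLaw π s)

/-- The gain-dropping time `T_drop`: the maximum of `T_drop^π` over deterministic policies, as a
real number (it is finite for every finite MDP). -/
noncomputable def dropTime (M : MDP S A) : ℝ :=
  (⨆ d : S → A, M.policyDropTime (detPolicy d)).toReal

end GainDropping

section Algorithms

/-- The number of Halpern steps, `E = ⌊1/(1-γ)⌋ - 1`. -/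
noncomputable def halpernSteps (γ : ℝ) : ℕ := ⌊1 / (1 - γ)⌋₊ - 1

/-- The weights `β_t = 1 - 2/(t+2)`. -/
noncomputable def halpernWeight (t : ℕ) : ℝ := 1 - 2 / ((t : ℝ) + 2)

/-- The iterates of Halpern-Then-Picard: Halpern steps for `t < E`, Picard steps for `t ≥ E`. -/
noncomputable def halpernThenPicard {X : Type*} [AddCommGroup X] [Module ℝ X]
    (x₀ : X) (γ : ℝ) (L : X → X) : ℕ → X
  | 0 => x₀
  | t + 1 =>
    if t < halpernSteps γ then
      (1 - halpernWeight (t + 1)) • x₀ +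
        halpernWeight (t + 1) • L (halpernThenPicard x₀ γ L t)
    else L (halpernThenPicard x₀ γ L t)

variable {S A : Type*} [Fintype S] [Fintype A] [Nonempty A]

/-- The vector `V` returned by Warm-Start Halpern-Then-Picard run for `N ≥ E' = ⌊1/(1-γ)⌋`
iterations: `E'` undiscounted value iterations from `0`, then `N - E'` iterations of
Halpern-Then-Picard with `𝒯_γ`. -/
noncomputable def warmStartVector (M : MDP S A) (γ : ℝ) (N : ℕ) : S → ℝ :=
  halpernThenPicard ((M.bellman 1)^[⌊1 / (1 - γ)⌋₊] 0) γ (M.bellman γ) (N - ⌊1 / (1 - γ)⌋₊)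

/-- `d` is a policy that Warm-Start Halpern-Then-Picard may return when run for `N` iterations:
`d(s) ∈ argmax_a (r(s,a) + γ P_{sa} V)`, with ties broken in any way. -/
def IsWarmStartOutput (M : MDP S A) (γ : ℝ) (N : ℕ) (d : S → A) : Prop :=
  ∀ s a, M.r s a + γ * M.expNext s a (M.warmStartVector γ N) ≤
    M.r s (d s) + γ * M.expNext s (d s) (M.warmStartVector γ N)

end Algorithms

end MDP

namespace MDP

/-! Write `ρ` for the optimal gain. The bound rests on two certificates of size `K`: a vector `0 ≤
hu ≤ K` with `r + P hu ≤ ρ + hu` for every action, and a vector `-K ≤ hl ≤ 0` with `ρ + hl ≤ r + P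
hl` for some gain-preserving action in each state. With `γ n = n - 1`, they trap both the warm start
(`n` undiscounted iterations) and the discounted fixed point between `n ρ + hl` and `n ρ + hu`, so
the two are within `2 K`. Halpern iteration of a nonexpansive map then has residual `O(K / n)` after
`n - 1` steps, and the final Picard step does not increase it (`warmStartVector_bounds`).

The returned `V` is within `3 K` of `n ρ`. Greediness has two consequences. Comparison with a
gain-preserving action shows that the output policy loses only `O((1 + K) / n)` of `ρ` per step. The
small residual shows that its reward is at least `ρ - O(K / n)` up to a coboundary. Gain is lost
only at gain-dropping steps, whose expected number is at most `T_drop`, and averaging along the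
chain gives `optGain_sub_gain_le`.

For `K = sp(h)`, both certificates are shifts of `h`. For the other bound, the Blackwell bias `b`
satisfies the upper inequality only for gain-preserving actions; this comes from the Laurent
expansion of discounted values. The repair adds `(1 + sp(b)) G`, where `G ≤ T_drop` is a potential
that falls in expectation by at least one at each gain-dropping action (`exists_drop_potential`). -/

theorem exists_abs_le {α : Type*} [Finite α] (g : α → ℝ) : ∃ C, 0 ≤ C ∧ ∀ x, |g x| ≤ C := by
  cases nonempty_fintype α
  exact ⟨∑ x, |g x|, Finset.sum_nonneg fun _ _ => abs_nonneg _, fun x =>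
    Finset.single_le_sum (f := fun x => |g x|) (fun _ _ => abs_nonneg _) (Finset.mem_univ x)⟩

/-! ### Real-valued expectations under finite PMFs -/

theorem _root_.PMF.sum_toReal_eq_one {α : Type*} [Fintype α] (p : PMF α) :
    ∑ a, (p a).toReal = 1 := by
  rw [← ENNReal.toReal_sum fun a _ => p.apply_ne_top a, ← tsum_fintype (L := .unconditional _),
    p.tsum_coe, ENNReal.toReal_one]

theorem sum_toReal_bind {α β : Type*} [Fintype α] [Fintype β] (p : PMF α) (f : α → PMF β)
    (g : β → ℝ) :
    ∑ b, (p.bind f b).toReal * g b = ∑ a, (p a).toReal * ∑ b, (f a b).toReal * g b := by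
  simp only [PMF.bind_apply, tsum_fintype]
  simp_rw [ENNReal.toReal_sum fun a _ =>
    ENNReal.mul_ne_top (p.apply_ne_top a) ((f a).apply_ne_top _), ENNReal.toReal_mul,
    Finset.sum_mul, Finset.mul_sum]
  rw [Finset.sum_comm]
  simp only [mul_assoc]

theorem sum_toReal_map {α β : Type*} [Fintype α] [Fintype β] (p : PMF α) (f : α → β)
    (g : β → ℝ) :
    ∑ b, (p.map f b).toReal * g b = ∑ a, (p a).toReal * g (f a) := by
  classical
  rw [PMF.map, sum_toReal_bind]
  refine Finset.sum_congr rfl fun a _ => ?_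
  congr 1
  simp only [Function.comp_apply, PMF.pure_apply]
  rw [Finset.sum_eq_single (f a)] <;> simp +contextual

/-! ### State chain induced by a policy -/

section PolicyAverages

variable {S A : Type*} [Fintype A]

/-- The average of a function of state-action pairs over the actions chosen by `π`. -/
noncomputable def policyAvg (π : Policy S A) (g : S × A → ℝ) (s : S) : ℝ :=
  ∑ a, (π s a).toReal * g (s, a)

theorem policyAvg_detPolicy (d : S → A) (g : S × A → ℝ) (s : S) :
    policyAvg (detPolicy d) g s = g (s, d s) := by
  classical
  simp only [policyAvg, detPolicy, PMF.pure_apply]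
  rw [Finset.sum_eq_single (d s)]
  · simp
  · intro a _ ha
    simp [ha]
  · simp

variable [Fintype S]

/-- The transition operator of the Markov chain on states induced by `π`. -/
noncomputable def transOp (M : MDP S A) (π : Policy S A) : (S → ℝ) →ₗ[ℝ] (S → ℝ) where
  toFun f s := ∑ a, (π s a).toReal * M.expNext s a f
  map_add' f g := by
    ext s
    simp only [expNext, Pi.add_apply, mul_add, Finset.sum_add_distrib]
  map_smul' c f := by
    ext s
    simp only [expNext, Pi.smul_apply, smul_eq_mul, RingHom.id_apply, Finset.mul_sum]
    refine Finset.sum_congr rfl fun a _ => Finset.sum_congr rfl fun s' _ => by ring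

theorem transOp_apply (M : MDP S A) (π : Policy S A) (f : S → ℝ) (s : S) :
    M.transOp π f s = policyAvg π (fun x => M.expNext x.1 x.2 f) s := rfl

end PolicyAverages

/-! ### From trajectory integrals to powers of the transition operator -/

section Trajectories

variable {S A : Type*} [Fintype S] [MeasurableSpace S] [DiscreteMeasurableSpace S]
  [Fintype A] [MeasurableSpace A] [DiscreteMeasurableSpace A]

theorem integral_stepKernel (M : MDP S A) (π : Policy S A) (g : S × A → ℝ) (x : S × A) :
    ∫ y, g y ∂(M.stepKernel π x) = M.expNext x.1 x.2 (policyAvg π g) := by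
  change ∫ y, g y ∂(PMF.toMeasure _) = _
  rw [PMF.integral_eq_sum]
  simp only [smul_eq_mul]
  rw [sum_toReal_bind]
  simp only [sum_toReal_map]
  rfl

instance isProbabilityMeasure_trajLaw (M : MDP S A) (π : Policy S A) (s : S) :
    IsProbabilityMeasure (M.trajLaw π s) := by
  have : IsProbabilityMeasure ((π s).map fun a => (s, a)).toMeasure :=
    PMF.toMeasure.isProbabilityMeasure _
  unfold trajLaw
  infer_instance

theorem measurable_coord (g : S × A → ℝ) (t : ℕ) :
    Measurable fun ω : ℕ → S × A => g (ω t) :=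
  (Measurable.of_discrete (f := g)).comp (measurable_pi_apply t)

theorem integrable_coord (M : MDP S A) (π : Policy S A) (s : S) (g : S × A → ℝ) (t : ℕ) :
    Integrable (fun ω => g (ω t)) (M.trajLaw π s) := by
  obtain ⟨C, -, hC⟩ := exists_abs_le g
  exact Integrable.of_bound (measurable_coord g t).aestronglyMeasurable C
    (Eventually.of_forall fun ω => by simpa using hC (ω t))

theorem map_zero_trajLaw (M : MDP S A) (π : Policy S A) (s : S) :
    (M.trajLaw π s).map (fun ω => ω 0) = ((π s).map fun a => (s, a)).toMeasure := by
  have : IsProbabilityMeasure ((π s).map fun a => (s, a)).toMeasure :=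
    PMF.toMeasure.isProbabilityMeasure _
  have h0 : (fun ω : ℕ → S × A => ω 0) =
      (fun x : (i : Finset.Iic 0) → S × A => x ⟨0, Finset.mem_Iic.2 le_rfl⟩) ∘
        Preorder.frestrictLe 0 := rfl
  rw [h0, ← Measure.map_map (by fun_prop) (by fun_prop), trajLaw, Kernel.trajMeasure,
    Measure.map_comp _ _ (by fun_prop), Kernel.traj_map_frestrictLe, Kernel.partialTraj_self,
    Measure.id_comp, Measure.map_map (by fun_prop) (by fun_prop)]
  convert! Measure.map_id

theorem integral_zero (M : MDP S A) (π : Policy S A) (s : S) (g : S × A → ℝ) :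
    ∫ ω, g (ω 0) ∂(M.trajLaw π s) = policyAvg π g s := by
  have := integral_map (μ := M.trajLaw π s) (φ := fun ω => ω 0) (f := g)
    (measurable_pi_apply 0).aemeasurable
    (Measurable.of_discrete (f := g)).aestronglyMeasurable
  rw [← this, map_zero_trajLaw, PMF.integral_eq_sum]
  simp only [smul_eq_mul, sum_toReal_map]
  rfl

/-- The Markov property: the joint law of the history up to `t` and the next pair is a
composition-product, and the kernel sees only the last pair of the history. -/
theorem integral_succ (M : MDP S A) (π : Policy S A) (s : S) (g : S × A → ℝ) (t : ℕ) :
    ∫ ω, g (ω (t + 1)) ∂(M.trajLaw π s) =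
      ∫ ω, M.expNext (ω t).1 (ω t).2 (policyAvg π g) ∂(M.trajLaw π s) := by
  have : IsProbabilityMeasure ((π s).map fun a => (s, a)).toMeasure :=
    PMF.toMeasure.isProbabilityMeasure _
  have key := Kernel.map_frestrictLe_trajMeasure_compProd_eq_map_trajMeasure
    (X := fun _ => S × A) (μ₀ := ((π s).map fun a => (s, a)).toMeasure)
    (κ := fun n => (M.stepKernel π).comap
      (fun ω : (i : Finset.Iic n) → S × A => ω ⟨n, Finset.mem_Iic.2 le_rfl⟩)
      (measurable_pi_apply _)) (a := t)
  change (M.trajLaw π s).map _ ⊗ₘ _ = (M.trajLaw π s).map _ at key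
  have hg : Measurable fun p : ((i : Finset.Iic t) → S × A) × (S × A) => g p.2 :=
    (Measurable.of_discrete (f := g)).comp measurable_snd
  have h1 := integral_map (μ := M.trajLaw π s)
    (φ := fun ω : ℕ → S × A => (Preorder.frestrictLe (π := fun _ => S × A) t ω, ω (t + 1)))
    (f := fun p => g p.2) (by fun_prop) hg.aestronglyMeasurable
  rw [← key] at h1
  change _ = ∫ ω, g (ω (t + 1)) ∂(M.trajLaw π s) at h1
  have : IsProbabilityMeasure ((M.trajLaw π s).map
      (Preorder.frestrictLe (π := fun _ => S × A) t)) :=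
    Measure.isProbabilityMeasure_map (by fun_prop)
  obtain ⟨C, -, hC⟩ := exists_abs_le g
  rw [← h1, Measure.integral_compProd (Integrable.of_bound hg.aestronglyMeasurable C
    (Eventually.of_forall fun p => by simpa using hC p.2))]
  simp only [Kernel.comap_apply, integral_stepKernel]
  rw [integral_map (by fun_prop)]
  · rfl
  · exact ((Measurable.of_discrete
      (f := fun x : S × A => M.expNext x.1 x.2 (policyAvg π g))).comp
        (measurable_pi_apply _)).aestronglyMeasurable

theorem integral_coord (M : MDP S A) (π : Policy S A) (s : S) (g : S × A → ℝ) (t : ℕ) :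
    ∫ ω, g (ω t) ∂(M.trajLaw π s) = ((M.transOp π ^ t) (policyAvg π g)) s := by
  induction t generalizing g with
  | zero => simpa using M.integral_zero π s g
  | succ t ih =>
    rw [integral_succ, ih fun x => M.expNext x.1 x.2 (policyAvg π g), pow_succ]
    rfl

end Trajectories

/-! ### Ergodic and discounted sums of Markov operators -/

section MarkovOperators

/-- A linear operator on functions on a finite set which is given by a stochastic matrix. -/
structure IsMarkovOp {S : Type*} (P : (S → ℝ) →ₗ[ℝ] (S → ℝ)) : Prop where
  nonneg : ∀ f, 0 ≤ f → 0 ≤ P f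
  map_one : P 1 = 1

namespace IsMarkovOp

variable {S : Type*} {P : (S → ℝ) →ₗ[ℝ] (S → ℝ)}

theorem mono (hP : IsMarkovOp P) {f g : S → ℝ} (hfg : f ≤ g) : P f ≤ P g := by
  have := hP.nonneg (g - f) (sub_nonneg.2 hfg)
  rwa [map_sub, sub_nonneg] at this

theorem map_const (hP : IsMarkovOp P) (c : ℝ) : P (fun _ => c) = fun _ => c := by
  have : (fun _ : S => c) = c • (1 : S → ℝ) := by ext; simp
  rw [this, map_smul, hP.map_one]

theorem pow (hP : IsMarkovOp P) (t : ℕ) : IsMarkovOp (P ^ t) := by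
  induction t with
  | zero => exact ⟨fun f hf => hf, rfl⟩
  | succ t ih =>
    refine ⟨fun f hf => ?_, ?_⟩
    · rw [pow_succ]
      exact ih.nonneg _ (hP.nonneg _ hf)
    · rw [pow_succ, Module.End.mul_apply, hP.map_one, ih.map_one]

theorem apply_le (hP : IsMarkovOp P) {f : S → ℝ} {c : ℝ} (hf : ∀ s, f s ≤ c) (s : S) :
    P f s ≤ c := by
  have := hP.mono (g := fun _ => c) hf s
  rwa [hP.map_const] at this

theorem le_apply (hP : IsMarkovOp P) {f : S → ℝ} {c : ℝ} (hf : ∀ s, c ≤ f s) (s : S) :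
    c ≤ P f s := by
  have := hP.mono (f := fun _ => c) hf s
  rwa [hP.map_const] at this

theorem abs_apply_le (hP : IsMarkovOp P) {f : S → ℝ} {c : ℝ} (hf : ∀ s, |f s| ≤ c) (s : S) :
    |P f s| ≤ c :=
  abs_le.2 ⟨hP.le_apply (fun s => (abs_le.1 (hf s)).1) s,
    hP.apply_le (fun s => (abs_le.1 (hf s)).2) s⟩

/-- Coboundaries telescope. This turns one-step relations into statements about gains, biases and
total gain loss. -/
theorem sum_pow_sub (P : (S → ℝ) →ₗ[ℝ] (S → ℝ)) (w : S → ℝ) (T : ℕ) :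
    ∑ t ∈ Finset.range T, (P ^ t) (w - P w) = w - (P ^ T) w := by
  induction T with
  | zero => simp
  | succ T ih =>
    rw [Finset.sum_range_succ, ih, map_sub, pow_succ, Module.End.mul_apply]
    abel

theorem sum_pow_sub_smul (P : (S → ℝ) →ₗ[ℝ] (S → ℝ)) (γ : ℝ) (v : S → ℝ) (T : ℕ) :
    ∑ t ∈ Finset.range T, γ ^ t • (P ^ t) (v - γ • P v) = v - γ ^ T • (P ^ T) v := by
  induction T with
  | zero => simp
  | succ T ih =>
    rw [Finset.sum_range_succ, ih, map_sub, map_smul, pow_succ P, Module.End.mul_apply, smul_sub,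
      smul_smul, ← pow_succ]
    abel

theorem pow_apply_of_fixed {u : S → ℝ} (hu : P u = u) (t : ℕ) : (P ^ t) u = u := by
  induction t with
  | zero => rfl
  | succ t ih => rw [pow_succ, Module.End.mul_apply, hu, ih]

theorem tendsto_pow_div (hP : IsMarkovOp P) [Finite S] (w : S → ℝ) (s : S) :
    Tendsto (fun T : ℕ => (1 / (T : ℝ)) * (P ^ T) w s) atTop (𝓝 0) := by
  obtain ⟨C, hC0, hC⟩ := exists_abs_le w
  refine squeeze_zero_norm (a := fun T : ℕ => (1 / (T : ℝ)) * C) (fun T => ?_) ?_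
  · rw [norm_mul, Real.norm_eq_abs, Real.norm_eq_abs, abs_of_nonneg (by positivity)]
    exact mul_le_mul_of_nonneg_left ((hP.pow T).abs_apply_le hC s) (by positivity)
  · simpa using tendsto_one_div_atTop_nhds_zero_nat.mul_const C

/-- Mean ergodic convergence along a decomposition of `f` into an invariant part and a
coboundary. -/
theorem tendsto_cesaro (hP : IsMarkovOp P) [Finite S] {f u w : S → ℝ} (hu : P u = u)
    (hf : f = u + (w - P w)) (s : S) :
    Tendsto (fun T : ℕ => (1 / (T : ℝ)) * ∑ t ∈ Finset.range T, (P ^ t) f s) atTop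
      (𝓝 (u s)) := by
  have h1 : ∀ T : ℕ, ∑ t ∈ Finset.range T, (P ^ t) f s = T * u s + (w s - (P ^ T) w s) := by
    intro T
    have := congrFun (sum_pow_sub P w T) s
    simp only [Finset.sum_apply, Pi.sub_apply] at this
    rw [← this, hf]
    simp only [map_add, Pi.add_apply, Finset.sum_add_distrib, pow_apply_of_fixed hu]
    simp
  have h2 : Tendsto (fun T : ℕ => u s + ((1 / (T : ℝ)) * w s - (1 / (T : ℝ)) * (P ^ T) w s))
      atTop (𝓝 (u s + (0 * w s - 0))) :=
    ((tendsto_one_div_atTop_nhds_zero_nat.mul_const (w s)).sub (hP.tendsto_pow_div w s)).const_add _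
  rw [zero_mul, sub_zero, add_zero] at h2
  refine h2.congr' ?_
  filter_upwards [eventually_gt_atTop 0] with T hT
  have : (T : ℝ) ≠ 0 := by positivity
  rw [h1]
  field_simp

/-- Every function on a finite set is the sum of an invariant function and a coboundary. -/
theorem exists_decomposition (hP : IsMarkovOp P) [Finite S] (f : S → ℝ) :
    ∃ u w, P u = u ∧ f = u + (w - P w) := by
  cases nonempty_fintype S
  set L : (S → ℝ) →ₗ[ℝ] (S → ℝ) := LinearMap.id - P with hL
  have hdisj : Disjoint (LinearMap.ker L) (LinearMap.range L) := by
    rw [Submodule.disjoint_def]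
    rintro x hx ⟨w, hw⟩
    have hx' : P x = x := by
      rw [LinearMap.mem_ker, hL, LinearMap.sub_apply, LinearMap.id_apply, sub_eq_zero] at hx
      exact hx.symm
    have hw' : x = 0 + (w - P w) := by rw [← hw, zero_add]; rfl
    have hw2 : x = x + ((0 : S → ℝ) - P 0) := by simp
    -- A fixed point that is also a coboundary has Cesàro averages tending both to itself and to
    -- zero. Rank-nullity then makes kernel and range of `1 - P` complementary.
    ext s
    exact tendsto_nhds_unique (hP.tendsto_cesaro hx' hw2 s)
      (hP.tendsto_cesaro (map_zero P) hw' s)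
  have htop := Submodule.eq_top_of_disjoint _ _
    (by rw [add_comm]; exact (LinearMap.finrank_range_add_finrank_ker L).ge) hdisj
  have hf : f ∈ LinearMap.ker L ⊔ LinearMap.range L := htop ▸ Submodule.mem_top
  obtain ⟨u, hu, y, ⟨w, rfl⟩, rfl⟩ := Submodule.mem_sup.1 hf
  refine ⟨u, w, ?_, rfl⟩
  rw [LinearMap.mem_ker, hL, LinearMap.sub_apply, LinearMap.id_apply, sub_eq_zero] at hu
  exact hu.symm

section Discounted

variable {γ : ℝ}

theorem summable_discounted (hP : IsMarkovOp P) [Finite S] (hγ0 : 0 ≤ γ) (hγ1 : γ < 1)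
    (f : S → ℝ) (s : S) : Summable fun t : ℕ => γ ^ t * (P ^ t) f s := by
  obtain ⟨C, hC0, hC⟩ := exists_abs_le f
  refine Summable.of_norm_bounded ((summable_geometric_of_lt_one hγ0 hγ1).mul_right C) fun t => ?_
  rw [Real.norm_eq_abs, abs_mul, abs_of_nonneg (pow_nonneg hγ0 t)]
  exact mul_le_mul_of_nonneg_left ((hP.pow t).abs_apply_le hC s) (pow_nonneg hγ0 t)

theorem hasSum_discounted_sub (hP : IsMarkovOp P) [Finite S] (hγ0 : 0 ≤ γ) (hγ1 : γ < 1)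
    (v : S → ℝ) (s : S) : HasSum (fun t : ℕ => γ ^ t * (P ^ t) (v - γ • P v) s) (v s) := by
  rw [(hP.summable_discounted hγ0 hγ1 _ s).hasSum_iff_tendsto_nat]
  have h1 := (hP.summable_discounted hγ0 hγ1 v s).tendsto_atTop_zero.const_sub (v s)
  rw [sub_zero] at h1
  refine h1.congr fun T => ?_
  have := congrFun (sum_pow_sub_smul P γ v T) s
  simp only [Finset.sum_apply, Pi.sub_apply, Pi.smul_apply, smul_eq_mul] at this
  exact this.symm

/-- Comparison principle: a supersolution `v` is itself the discounted sum of `v - γ P v`, which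
dominates `f` termwise. -/
theorem discounted_le (hP : IsMarkovOp P) [Finite S] (hγ0 : 0 ≤ γ) (hγ1 : γ < 1)
    {f v : S → ℝ} (h : ∀ s, f s + γ * P v s ≤ v s) (s : S) :
    ∑' t : ℕ, γ ^ t * (P ^ t) f s ≤ v s := by
  refine hasSum_le (fun t => ?_) (hP.summable_discounted hγ0 hγ1 f s).hasSum
    (hP.hasSum_discounted_sub hγ0 hγ1 v s)
  refine mul_le_mul_of_nonneg_left ((hP.pow t).mono (fun s => ?_) s) (pow_nonneg hγ0 t)
  have := h s
  simp only [Pi.sub_apply, Pi.smul_apply, smul_eq_mul]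
  linarith

theorem le_discounted (hP : IsMarkovOp P) [Finite S] (hγ0 : 0 ≤ γ) (hγ1 : γ < 1)
    {f v : S → ℝ} (h : ∀ s, v s ≤ f s + γ * P v s) (s : S) :
    v s ≤ ∑' t : ℕ, γ ^ t * (P ^ t) f s := by
  refine hasSum_le (fun t => ?_) (hP.hasSum_discounted_sub hγ0 hγ1 v s)
    (hP.summable_discounted hγ0 hγ1 f s).hasSum
  refine mul_le_mul_of_nonneg_left ((hP.pow t).mono (fun s => ?_) s) (pow_nonneg hγ0 t)
  have := h s
  simp only [Pi.sub_apply, Pi.smul_apply, smul_eq_mul]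
  linarith

/-- The first two terms of the Laurent expansion of the discounted sums around `γ = 1`. -/
theorem exists_laurent_bound (hP : IsMarkovOp P) [Finite S] {f u z : S → ℝ} (hu : P u = u)
    (hf : f = u + ((z - P z) - P (z - P z))) :
    ∃ C, 0 ≤ C ∧ ∀ γ, 0 ≤ γ → γ < 1 → ∀ s,
      |∑' t : ℕ, γ ^ t * (P ^ t) f s - (u s / (1 - γ) + (z - P z) s)| ≤ C * (1 - γ) := by
  obtain ⟨C, hC0, hC⟩ := exists_abs_le z
  refine ⟨2 * C, by positivity, fun γ hγ0 hγ1 s => ?_⟩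
  have hγ : 0 < 1 - γ := sub_pos.2 hγ1
  have hPz := hP.abs_apply_le hC
  have hPPz := hP.abs_apply_le hPz
  have hexp : ∀ c s, P (fun s => u s / (1 - γ) + (z - P z) s - (1 - γ) * (P z s + c)) s =
      u s / (1 - γ) + (P z s - P (P z) s) - (1 - γ) * (P (P z) s + c) := by
    intro c s
    have : (fun s => u s / (1 - γ) + (z - P z) s - (1 - γ) * (P z s + c)) =
        (1 - γ)⁻¹ • u + (z - P z) - (1 - γ) • (P z + fun _ => c) := by
      ext s
      simp [div_eq_inv_mul, mul_add]
    rw [this]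
    simp only [map_add, map_sub, map_smul, hu, hP.map_const]
    simp [div_eq_inv_mul, mul_add]
  have hfs : ∀ s, f s = u s + ((z s - P z s) - (P z s - P (P z) s)) := by
    intro s
    rw [hf]
    simp
  have hdiv : ∀ s, u s / (1 - γ) = u s + γ * (u s / (1 - γ)) := by
    intro s
    field_simp
    ring
  -- With `ε = 1 - γ`, the trial function `u / ε + (z - P z) - ε (P z + c)` solves the discounted
  -- equation up to `ε² (P² z + c)`. Taking `c = C` or `c = -C` fixes the sign, giving a subsolution
  -- and a supersolution.
  have h1 := hP.le_discounted hγ0 hγ1 (f := f)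
    (v := fun s => u s / (1 - γ) + (z - P z) s - (1 - γ) * (P z s + C)) (fun s => by
      rw [hexp, hfs]
      have := hdiv s
      have h2 := (abs_le.1 (hPPz s)).1
      simp only [Pi.sub_apply]
      nlinarith [mul_nonneg (mul_nonneg hγ.le hγ.le) (by linarith : 0 ≤ P (P z) s + C)]) s
  have h2 := hP.discounted_le hγ0 hγ1 (f := f)
    (v := fun s => u s / (1 - γ) + (z - P z) s - (1 - γ) * (P z s + -C)) (fun s => by
      rw [hexp, hfs]
      have := hdiv s
      have h2 := (abs_le.1 (hPPz s)).2
      simp only [Pi.sub_apply]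
      nlinarith [mul_nonneg (mul_nonneg hγ.le hγ.le) (by linarith : 0 ≤ C - P (P z) s)]) s
  have h3 := abs_le.1 (hPz s)
  have h4 := mul_le_mul_of_nonneg_left h3.1 hγ.le
  have h5 := mul_le_mul_of_nonneg_left h3.2 hγ.le
  rw [abs_le]
  constructor <;> linarith

end Discounted

end IsMarkovOp

end MarkovOperators
-- Gain, bias and discounted value of a stationary policy
section Evaluation

variable {S A : Type*}

section

variable [Fintype A]

theorem policyAvg_const (π : Policy S A) (c : S → ℝ) (s : S) :
    policyAvg π (fun x => c x.1) s = c s := by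
  simp only [policyAvg]
  rw [← Finset.sum_mul, PMF.sum_toReal_eq_one, one_mul]

theorem policyAvg_mono (π : Policy S A) {f g : S × A → ℝ} (s : S)
    (h : ∀ a, f (s, a) ≤ g (s, a)) : policyAvg π f s ≤ policyAvg π g s :=
  Finset.sum_le_sum fun a _ => mul_le_mul_of_nonneg_left (h a) ENNReal.toReal_nonneg

theorem policyAvg_add (π : Policy S A) (f g : S × A → ℝ) (s : S) :
    policyAvg π (fun x => f x + g x) s = policyAvg π f s + policyAvg π g s := by
  simp only [policyAvg, mul_add, Finset.sum_add_distrib]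

theorem policyAvg_sub (π : Policy S A) (f g : S × A → ℝ) (s : S) :
    policyAvg π (fun x => f x - g x) s = policyAvg π f s - policyAvg π g s := by
  simp only [policyAvg, mul_sub, Finset.sum_sub_distrib]

theorem policyAvg_mul (π : Policy S A) (c : ℝ) (f : S × A → ℝ) (s : S) :
    policyAvg π (fun x => c * f x) s = c * policyAvg π f s := by
  simp only [policyAvg, Finset.mul_sum]
  exact Finset.sum_congr rfl fun _ _ => by ring

/-- The expected one-step reward under `π`. -/
noncomputable def policyReward (M : MDP S A) (π : Policy S A) : S → ℝ :=
  policyAvg π fun x => M.r x.1 x.2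

theorem policyReward_nonneg (M : MDP S A) (π : Policy S A) (s : S) : 0 ≤ M.policyReward π s :=
  Finset.sum_nonneg fun a _ => mul_nonneg ENNReal.toReal_nonneg (M.r_mem s a).1

theorem policyReward_detPolicy (M : MDP S A) (d : S → A) (s : S) :
    M.policyReward (detPolicy d) s = M.r s (d s) :=
  policyAvg_detPolicy d _ s

end

variable [Fintype S]

theorem expNext_mono (M : MDP S A) (s : S) (a : A) {f g : S → ℝ} (h : ∀ s, f s ≤ g s) :
    M.expNext s a f ≤ M.expNext s a g :=
  Finset.sum_le_sum fun s' _ => mul_le_mul_of_nonneg_left (h s') ENNReal.toReal_nonneg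

theorem expNext_const (M : MDP S A) (s : S) (a : A) (c : ℝ) :
    M.expNext s a (fun _ => c) = c := by
  rw [expNext, ← Finset.sum_mul, PMF.sum_toReal_eq_one, one_mul]

theorem expNext_add (M : MDP S A) (s : S) (a : A) (f g : S → ℝ) :
    M.expNext s a (fun s => f s + g s) = M.expNext s a f + M.expNext s a g := by
  simp only [expNext, mul_add, Finset.sum_add_distrib]

theorem expNext_sub (M : MDP S A) (s : S) (a : A) (f g : S → ℝ) :
    M.expNext s a (fun s => f s - g s) = M.expNext s a f - M.expNext s a g := by
  simp only [expNext, mul_sub, Finset.sum_sub_distrib]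

theorem expNext_mul (M : MDP S A) (s : S) (a : A) (c : ℝ) (f : S → ℝ) :
    M.expNext s a (fun s => c * f s) = c * M.expNext s a f := by
  simp only [expNext, Finset.mul_sum]
  exact Finset.sum_congr rfl fun _ _ => by ring

theorem expNext_le (M : MDP S A) (s : S) (a : A) {f : S → ℝ} {c : ℝ} (h : ∀ s, f s ≤ c) :
    M.expNext s a f ≤ c :=
  (M.expNext_mono s a h).trans_eq (M.expNext_const s a c)

theorem le_expNext (M : MDP S A) (s : S) (a : A) {f : S → ℝ} {c : ℝ} (h : ∀ s, c ≤ f s) :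
    c ≤ M.expNext s a f :=
  (M.expNext_const s a c).symm.trans_le (M.expNext_mono s a h)

variable [Fintype A]

theorem isMarkovOp_transOp (M : MDP S A) (π : Policy S A) : IsMarkovOp (M.transOp π) := by
  refine ⟨fun f hf s => ?_, ?_⟩
  · exact Finset.sum_nonneg fun a _ => mul_nonneg ENNReal.toReal_nonneg
      (Finset.sum_nonneg fun s' _ => mul_nonneg ENNReal.toReal_nonneg (hf s'))
  · ext s
    have : ∀ a, M.expNext s a 1 = 1 := fun a => M.expNext_const s a 1
    simp only [transOp, LinearMap.coe_mk, AddHom.coe_mk, this, mul_one, PMF.sum_toReal_eq_one,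
      Pi.one_apply]

theorem transOp_detPolicy (M : MDP S A) (d : S → A) (f : S → ℝ) (s : S) :
    M.transOp (detPolicy d) f s = M.expNext s (d s) f := by
  rw [transOp_apply, policyAvg_detPolicy]

variable [MeasurableSpace S] [DiscreteMeasurableSpace S] [MeasurableSpace A]
  [DiscreteMeasurableSpace A]

theorem integral_sum_coord (M : MDP S A) (π : Policy S A) (s : S) (g : S × A → ℝ) (T : ℕ) :
    ∫ ω, ∑ t ∈ Finset.range T, g (ω t) ∂(M.trajLaw π s) =
      ∑ t ∈ Finset.range T, (M.transOp π ^ t) (policyAvg π g) s := by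
  rw [integral_finsetSum _ fun t _ => M.integrable_coord π s g t]
  exact Finset.sum_congr rfl fun t _ => M.integral_coord π s g t

theorem value_eq_tsum (M : MDP S A) {γ : ℝ} (hγ0 : 0 ≤ γ) (hγ1 : γ < 1) (π : Policy S A) (s : S) :
    M.value γ π s = ∑' t : ℕ, γ ^ t * (M.transOp π ^ t) (M.policyReward π) s := by
  have h1 : ∀ t : ℕ, Integrable (fun ω : ℕ → S × A => γ ^ t * M.r (ω t).1 (ω t).2)
      (M.trajLaw π s) := fun t =>
    (M.integrable_coord π s (fun x => M.r x.1 x.2) t).const_mul _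
  have h2 := hasSum_integral_of_summable_integral_norm h1 (by
    refine Summable.of_nonneg_of_le (fun t => integral_nonneg fun ω => norm_nonneg _) (fun t => ?_)
      (summable_geometric_of_lt_one hγ0 hγ1)
    have : ∀ ω : ℕ → S × A, ‖γ ^ t * M.r (ω t).1 (ω t).2‖ ≤ γ ^ t := by
      intro ω
      have hr := M.r_mem (ω t).1 (ω t).2
      rw [norm_mul, Real.norm_eq_abs, Real.norm_eq_abs, abs_of_nonneg (pow_nonneg hγ0 t),
        abs_of_nonneg hr.1]
      exact mul_le_of_le_one_right (pow_nonneg hγ0 t) hr.2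
    calc ∫ ω, ‖γ ^ t * M.r (ω t).1 (ω t).2‖ ∂(M.trajLaw π s)
        ≤ ∫ _, γ ^ t ∂(M.trajLaw π s) :=
          integral_mono (h1 t).norm (integrable_const _) this
      _ = γ ^ t := by simp)
  rw [value, ← h2.tsum_eq]
  refine tsum_congr fun t => ?_
  rw [integral_const_mul, M.integral_coord π s (fun x => M.r x.1 x.2) t]
  rfl

theorem le_value_of_eq (M : MDP S A) {γ : ℝ} (hγ0 : 0 ≤ γ) (hγ1 : γ < 1) {v : S → ℝ}
    {d : S → A} (hd : ∀ s, v s = M.r s (d s) + γ * M.expNext s (d s) v) (s : S) :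
    v s ≤ M.value γ (detPolicy d) s := by
  rw [M.value_eq_tsum hγ0 hγ1]
  refine (M.isMarkovOp_transOp _).le_discounted hγ0 hγ1 (fun s => ?_) s
  rw [policyReward_detPolicy, transOp_detPolicy]
  exact (hd s).le

/-- The gain and bias of a stationary policy satisfy its evaluation equations, the bias is a
coboundary, and they are the leading terms of the discounted value as `γ → 1`. -/
theorem exists_gain_bias_decomposition (M : MDP S A) (π : Policy S A) :
    ∃ z : S → ℝ, M.transOp π (M.gain π) = M.gain π ∧ M.bias π = z - M.transOp π z ∧
      M.policyReward π = M.gain π + (M.bias π - M.transOp π (M.bias π)) := by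
  have hP := M.isMarkovOp_transOp π
  set P := M.transOp π with hPdef
  obtain ⟨u, w, hu, hr⟩ := hP.exists_decomposition (M.policyReward π)
  -- The second decomposition handles the bias: partial sums are `w - P ^ T w`, whose Cesàro limit
  -- is `w - w₀ = z - P z`.
  obtain ⟨w₀, z, hw₀, hw⟩ := hP.exists_decomposition w
  have hgain : M.gain π = u := by
    ext s
    refine Tendsto.limUnder_eq ?_
    have := hP.tendsto_cesaro hu hr s
    refine this.congr fun T => ?_
    rw [M.integral_sum_coord π s (fun x => M.r x.1 x.2) T]
    rfl
  have hbias : M.bias π = z - P z := by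
    ext s
    refine Tendsto.limUnder_eq ?_
    have h1 : ∀ T : ℕ, ∫ ω, ∑ t ∈ Finset.range T, (M.r (ω t).1 (ω t).2 - M.gain π (ω t).1)
        ∂(M.trajLaw π s) = w s - (P ^ T) w s := by
      intro T
      rw [M.integral_sum_coord π s (fun x => M.r x.1 x.2 - M.gain π x.1) T]
      have : policyAvg π (fun x => M.r x.1 x.2 - M.gain π x.1) = w - P w := by
        ext s
        rw [policyAvg_sub, policyAvg_const, hgain]
        change M.policyReward π s - u s = _
        rw [hr]
        simp
      rw [this, ← hPdef]
      have := congrFun (IsMarkovOp.sum_pow_sub P w T) s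
      simpa only [Finset.sum_apply, Pi.sub_apply] using this
    have h2 := (hP.tendsto_cesaro hw₀ hw s).const_sub (w s)
    have h3 : w s - w₀ s = (z - P z) s := by
      rw [hw]
      simp
    rw [h3] at h2
    refine h2.congr' ?_
    filter_upwards [eventually_gt_atTop 0] with N hN
    have : (N : ℝ) ≠ 0 := by positivity
    simp_rw [h1]
    simp only [Finset.sum_sub_distrib, Finset.sum_const, Finset.card_range, nsmul_eq_mul]
    field_simp
  refine ⟨z, by rw [hgain, hu], hbias, ?_⟩
  have hw' : w - P w = (z - P z) - P (z - P z) := by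
    rw [hw, map_add, hw₀]
    abel
  rw [hgain, hbias, ← hw', hr]

theorem transOp_gain (M : MDP S A) (π : Policy S A) (s : S) :
    M.transOp π (M.gain π) s = M.gain π s := by
  obtain ⟨z, h, -, -⟩ := M.exists_gain_bias_decomposition π
  rw [h]

theorem policyReward_eq (M : MDP S A) (π : Policy S A) (s : S) :
    M.policyReward π s = M.gain π s + (M.bias π s - M.transOp π (M.bias π) s) := by
  obtain ⟨z, -, -, h⟩ := M.exists_gain_bias_decomposition π
  exact congrFun h s

theorem exists_abs_value_sub_le (M : MDP S A) (π : Policy S A) :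
    ∃ C, 0 ≤ C ∧ ∀ γ, 0 ≤ γ → γ < 1 → ∀ s,
      |M.value γ π s - (M.gain π s / (1 - γ) + M.bias π s)| ≤ C * (1 - γ) := by
  obtain ⟨z, hu, hb, hr⟩ := M.exists_gain_bias_decomposition π
  rw [hb] at hr
  obtain ⟨C, hC0, hC⟩ := (M.isMarkovOp_transOp π).exists_laurent_bound hu hr
  refine ⟨C, hC0, fun γ hγ0 hγ1 s => ?_⟩
  rw [M.value_eq_tsum hγ0 hγ1, hb]
  exact hC γ hγ0 hγ1 s

theorem tendsto_sum_gain (M : MDP S A) (π : Policy S A) (s : S) :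
    Tendsto (fun T : ℕ => (1 / (T : ℝ)) *
      ∑ t ∈ Finset.range T, (M.transOp π ^ t) (M.policyReward π) s) atTop (𝓝 (M.gain π s)) := by
  obtain ⟨z, hu, -, hr⟩ := M.exists_gain_bias_decomposition π
  exact (M.isMarkovOp_transOp π).tendsto_cesaro hu hr s

end Evaluation

theorem nonneg_of_forall_small {a K ε₀ : ℝ} (hε₀ : 0 < ε₀)
    (h : ∀ ε, 0 < ε → ε ≤ ε₀ → 0 ≤ a + ε * K) : 0 ≤ a := by
  have h1 : Tendsto (fun ε : ℝ => a + ε * K) (𝓝[>] 0) (𝓝 (a + 0 * K)) :=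
    tendsto_nhdsWithin_of_tendsto_nhds (Continuous.tendsto (by fun_prop) 0)
  rw [zero_mul, add_zero] at h1
  refine ge_of_tendsto h1 ?_
  filter_upwards [Ioc_mem_nhdsGT hε₀] with ε hε using h ε hε.1 hε.2

/-! ### Discounted Bellman operator and comparison with its fixed point -/

section Bellman

variable {S A : Type*} [Fintype S] [Fintype A] [Nonempty A]

theorem le_bellman (M : MDP S A) (γ : ℝ) (V : S → ℝ) (s : S) (a : A) :
    M.r s a + γ * M.expNext s a V ≤ M.bellman γ V s :=
  Finset.le_sup' (fun a => M.r s a + γ * M.expNext s a V) (Finset.mem_univ a)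

theorem bellman_le (M : MDP S A) {γ : ℝ} {V : S → ℝ} {s : S} {c : ℝ}
    (h : ∀ a, M.r s a + γ * M.expNext s a V ≤ c) : M.bellman γ V s ≤ c :=
  Finset.sup'_le _ _ fun a _ => h a

theorem exists_greedy (M : MDP S A) (γ : ℝ) (V : S → ℝ) :
    ∃ d : S → A, ∀ s, M.bellman γ V s = M.r s (d s) + γ * M.expNext s (d s) V := by
  have : ∀ s, ∃ a, M.bellman γ V s = M.r s a + γ * M.expNext s a V := by
    intro s
    obtain ⟨a, -, ha⟩ := Finset.exists_mem_eq_sup' Finset.univ_nonempty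
      fun a => M.r s a + γ * M.expNext s a V
    exact ⟨a, ha⟩
  choose d hd using this
  exact ⟨d, hd⟩

theorem bellman_sub_le (M : MDP S A) {γ : ℝ} (hγ : 0 ≤ γ) {V W : S → ℝ} {c : ℝ}
    (h : ∀ s, V s - W s ≤ c) (s : S) : M.bellman γ V s - M.bellman γ W s ≤ γ * c := by
  rw [sub_le_iff_le_add]
  refine M.bellman_le fun a => ?_
  have h1 := M.le_bellman γ W s a
  have h2 := mul_le_mul_of_nonneg_left (M.expNext_le s a h) hγ
  rw [expNext_sub, mul_sub] at h2
  linarith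

theorem norm_bellman_sub_le (M : MDP S A) {γ : ℝ} (hγ : 0 ≤ γ) (V W : S → ℝ) :
    ‖M.bellman γ V - M.bellman γ W‖ ≤ γ * ‖V - W‖ := by
  rw [pi_norm_le_iff_of_nonneg (by positivity)]
  intro s
  have h : ∀ s, |V s - W s| ≤ ‖V - W‖ := fun s => norm_le_pi_norm (V - W) s
  rw [Pi.sub_apply, Real.norm_eq_abs, abs_le']
  refine ⟨M.bellman_sub_le hγ (fun s => (le_abs_self _).trans (h s)) s, ?_⟩
  rw [neg_sub]
  exact M.bellman_sub_le hγ (fun s => by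
    have := (neg_le_abs (V s - W s)).trans (h s)
    linarith) s

theorem exists_bellman_fixed (M : MDP S A) {γ : ℝ} (hγ0 : 0 ≤ γ) (hγ1 : γ < 1) :
    ∃ v : S → ℝ, M.bellman γ v = v := by
  have h : ContractingWith ⟨γ, hγ0⟩ (M.bellman γ) := by
    refine ⟨by exact_mod_cast hγ1, LipschitzWith.of_dist_le_mul fun V W => ?_⟩
    rw [dist_eq_norm, dist_eq_norm]
    exact M.norm_bellman_sub_le hγ0 V W
  exact ⟨_, h.fixedPoint_isFixedPt⟩

/-- At a state maximising `v - U`, contraction bounds the maximum by `γ` times itself, so it is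
nonpositive. -/
theorem bellman_fixed_le (M : MDP S A) {γ : ℝ} (hγ0 : 0 ≤ γ) (hγ1 : γ < 1) {v U : S → ℝ}
    (hv : M.bellman γ v = v) (hU : ∀ s a, M.r s a + γ * M.expNext s a U ≤ U s) (s : S) :
    v s ≤ U s := by
  have : Nonempty S := ⟨s⟩
  obtain ⟨m, hm⟩ := Finite.exists_max fun s => v s - U s
  have h1 := M.bellman_sub_le hγ0 hm m
  have h2 : M.bellman γ U m ≤ U m := M.bellman_le (hU m)
  rw [hv] at h1
  have h3 := hm s
  nlinarith

theorem le_bellman_fixed (M : MDP S A) {γ : ℝ} (hγ0 : 0 ≤ γ) (hγ1 : γ < 1) {v U : S → ℝ}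
    (hv : M.bellman γ v = v) (hU : ∀ s, ∃ a, U s ≤ M.r s a + γ * M.expNext s a U) (s : S) :
    U s ≤ v s := by
  have : Nonempty S := ⟨s⟩
  obtain ⟨m, hm⟩ := Finite.exists_max fun s => U s - v s
  have h1 := M.bellman_sub_le hγ0 hm m
  obtain ⟨a, ha⟩ := hU m
  have h2 := M.le_bellman γ U m a
  rw [hv] at h1
  have h3 := hm s
  nlinarith

variable [MeasurableSpace S] [DiscreteMeasurableSpace S] [MeasurableSpace A]
  [DiscreteMeasurableSpace A]

theorem value_le_bellman_fixed (M : MDP S A) {γ : ℝ} (hγ0 : 0 ≤ γ) (hγ1 : γ < 1) {v : S → ℝ}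
    (hv : M.bellman γ v = v) (π : Policy S A) (s : S) : M.value γ π s ≤ v s := by
  rw [M.value_eq_tsum hγ0 hγ1]
  refine (M.isMarkovOp_transOp π).discounted_le hγ0 hγ1 (fun s => ?_) s
  rw [policyReward, transOp_apply, ← policyAvg_mul, ← policyAvg_add]
  refine (policyAvg_mono π s (g := fun x => v x.1) fun a => ?_).trans_eq (policyAvg_const π v s)
  have := M.le_bellman γ v s a
  rwa [hv] at this

/-- The fixed point bounds every policy from above and is attained by a greedy deterministic policy,
so it is the supremum. -/
theorem bellman_optValue (M : MDP S A) {γ : ℝ} (hγ0 : 0 ≤ γ) (hγ1 : γ < 1) :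
    M.bellman γ (M.optValue γ) = M.optValue γ ∧ ∀ π s, M.value γ π s ≤ M.optValue γ s := by
  obtain ⟨v, hv⟩ := M.exists_bellman_fixed hγ0 hγ1
  obtain ⟨d, hd⟩ := M.exists_greedy γ v
  rw [hv] at hd
  have hle := M.value_le_bellman_fixed hγ0 hγ1 hv
  have hopt : M.optValue γ = v := by
    ext s
    have : Nonempty (Policy S A) := ⟨detPolicy d⟩
    refine le_antisymm (ciSup_le fun π => hle π s) ?_
    exact (M.le_value_of_eq hγ0 hγ1 hd s).trans
      (le_ciSup (f := fun π => M.value γ π s) ⟨v s, by rintro _ ⟨π, rfl⟩; exact hle π s⟩ _)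
  rw [hopt]
  exact ⟨hv, hle⟩

end Bellman

/-! ### Vanishing-discount consequences of Blackwell optimality -/

section Blackwell

variable {S A : Type*} [Fintype S] [MeasurableSpace S] [DiscreteMeasurableSpace S]
  [Fintype A] [MeasurableSpace A] [DiscreteMeasurableSpace A]

theorem IsBlackwellOptimal.exists_small {M : MDP S A} {π : Policy S A}
    (h : M.IsBlackwellOptimal π) : ∃ ε₀ : ℝ, 0 < ε₀ ∧ ∀ ε, 0 < ε → ε ≤ ε₀ →
      0 ≤ 1 - ε ∧ ∀ s, M.value (1 - ε) π s = M.optValue (1 - ε) s := by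
  obtain ⟨γ₀, hγ₀, h⟩ := h
  -- The cap at `1` keeps `1 - ε` nonnegative when `γ₀` is negative.
  refine ⟨min 1 (1 - γ₀), lt_min one_pos (sub_pos.2 hγ₀), fun ε hε hε' => ?_⟩
  have h1 := hε'.trans (min_le_left _ _)
  have h2 := hε'.trans (min_le_right _ _)
  exact ⟨by linarith, h _ (by linarith) (by linarith) (by linarith)⟩

variable [Nonempty A]

/-- The gain is the coefficient of `1 / (1 - γ)` in the discounted value, so optimality near `γ = 1`
forces gain optimality. -/
theorem IsBlackwellOptimal.gain_le {M : MDP S A} {π : Policy S A} (h : M.IsBlackwellOptimal π)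
    (π' : Policy S A) (s : S) : M.gain π' s ≤ M.gain π s := by
  obtain ⟨ε₀, hε₀, h⟩ := h.exists_small
  obtain ⟨C, hC0, hC⟩ := M.exists_abs_value_sub_le π
  obtain ⟨C', hC0', hC'⟩ := M.exists_abs_value_sub_le π'
  rw [← sub_nonneg]
  refine nonneg_of_forall_small (lt_min hε₀ one_pos)
    (K := M.bias π s - M.bias π' s + C + C') fun ε hε hε' => ?_
  have hε1 := hε'.trans (min_le_right _ _)
  obtain ⟨hγ, hopt⟩ := h ε hε (hε'.trans (min_le_left _ _))
  have h1 := (abs_le.1 (hC (1 - ε) hγ (by linarith) s)).2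
  have h2 := (abs_le.1 (hC' (1 - ε) hγ (by linarith) s)).1
  have h3 := (M.bellman_optValue hγ (by linarith)).2 π' s
  rw [← hopt s] at h3
  rw [sub_sub_cancel] at h1 h2
  have h4 : 0 ≤ (M.gain π s / ε - M.gain π' s / ε) + (M.bias π s - M.bias π' s + C + C') := by
    nlinarith
  have h5 := mul_nonneg hε.le h4
  have h6 : ε * (M.gain π s / ε - M.gain π' s / ε) = M.gain π s - M.gain π' s := by
    field_simp
  rwa [mul_add, h6] at h5

theorem IsBlackwellOptimal.optGain_eq {M : MDP S A} {π : Policy S A}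
    (h : M.IsBlackwellOptimal π) : M.optGain = M.gain π := by
  ext s
  have : Nonempty (Policy S A) := ⟨π⟩
  exact le_antisymm (ciSup_le fun π' => h.gain_le π' s)
    (le_ciSup (f := fun π => M.gain π s)
      ⟨M.gain π s, by rintro _ ⟨π', rfl⟩; exact h.gain_le π' s⟩ π)

/-- The gain and bias of a Blackwell-optimal policy satisfy the second unmodified multichain
optimality inequality. -/
theorem IsBlackwellOptimal.reward_add_expNext_bias_le {M : MDP S A} {π : Policy S A}
    (h : M.IsBlackwellOptimal π) {s : S} {a : A}
    (ha : M.expNext s a M.optGain = M.optGain s) :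
    M.r s a + M.expNext s a (M.bias π) ≤ M.optGain s + M.bias π s := by
  rw [h.optGain_eq] at ha ⊢
  obtain ⟨ε₀, hε₀, h⟩ := h.exists_small
  obtain ⟨C, hC0, hC⟩ := M.exists_abs_value_sub_le π
  rw [← sub_nonneg]
  refine nonneg_of_forall_small hε₀ (K := M.expNext s a (M.bias π) + 2 * C) fun ε hε hε' => ?_
  obtain ⟨hγ, hopt⟩ := h ε hε hε'
  have hval : M.value (1 - ε) π = M.optValue (1 - ε) := funext hopt
  have h1 := M.le_bellman (1 - ε) (M.value (1 - ε) π) s a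
  rw [hval, (M.bellman_optValue hγ (by linarith)).1, ← hval] at h1
  have hC1 := hC (1 - ε) hγ (by linarith)
  rw [sub_sub_cancel] at hC1
  have h2 := (abs_le.1 (hC1 s)).2
  have h3 := M.expNext_mono s a (f := fun s => (ε⁻¹ * M.gain π s + M.bias π s) + -(C * ε))
    (g := M.value (1 - ε) π) fun s => by
      have := (abs_le.1 (hC1 s)).1
      rw [div_eq_inv_mul] at this
      linarith
  rw [expNext_add, expNext_add, expNext_mul, expNext_const, ha] at h3
  have h4 := mul_le_mul_of_nonneg_left h3 hγ
  have h5 : M.gain π s / ε = ε⁻¹ * M.gain π s := div_eq_inv_mul _ _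
  -- Because the action preserves the gain, the `ε⁻¹` terms cancel on both sides, leaving the bias
  -- inequality up to `O(ε)`.
  have h6 : (1 - ε) * (ε⁻¹ * M.gain π s) = ε⁻¹ * M.gain π s - M.gain π s := by
    field_simp
  nlinarith [mul_nonneg (mul_nonneg hC0 hε.le) hε.le]

/-- Invariance of the gain forces every action in the support of `π` to preserve it. The bias
equation holds on average over that support, so some action in it does at least as well as the
average. -/
theorem IsBlackwellOptimal.exists_action {M : MDP S A} {π : Policy S A}
    (h : M.IsBlackwellOptimal π) (hρ : ∀ s a, M.expNext s a M.optGain ≤ M.optGain s) (s : S) :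
    ∃ a, M.expNext s a M.optGain = M.optGain s ∧
      M.optGain s + M.bias π s ≤ M.r s a + M.expNext s a (M.bias π) := by
  have h1 := M.transOp_gain π s
  have h2 := M.policyReward_eq π s
  rw [← h.optGain_eq] at h1 h2
  have hsum := PMF.sum_toReal_eq_one (π s)
  have hzero : ∀ a, (π s a).toReal * (M.optGain s - M.expNext s a M.optGain) = 0 := by
    have h3 : ∑ a, (π s a).toReal * (M.optGain s - M.expNext s a M.optGain) = 0 := by
      rw [transOp_apply] at h1
      simp only [policyAvg] at h1
      simp only [mul_sub, Finset.sum_sub_distrib, h1, ← Finset.sum_mul, hsum]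
      ring
    have h4 := (Finset.sum_eq_zero_iff_of_nonneg fun a _ => mul_nonneg ENNReal.toReal_nonneg
      (sub_nonneg.2 (hρ s a))).1 h3
    exact fun a => h4 a (Finset.mem_univ a)
  have hge : ∑ a, (π s a).toReal * (M.optGain s + M.bias π s) ≤
      ∑ a, (π s a).toReal * (M.r s a + M.expNext s a (M.bias π)) := by
    rw [transOp_apply] at h2
    simp only [policyReward, policyAvg] at h2
    simp only [mul_add (π s _).toReal, Finset.sum_add_distrib, ← Finset.sum_mul, hsum, h2]
    linarith
  by_contra! hcon
  have hle : ∀ a, (π s a).toReal * (M.r s a + M.expNext s a (M.bias π)) ≤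
      (π s a).toReal * (M.optGain s + M.bias π s) := by
    intro a
    rcases eq_or_ne (π s a).toReal 0 with h0 | h0
    · simp [h0]
    · have := (mul_eq_zero.1 (hzero a)).resolve_left h0
      exact mul_le_mul_of_nonneg_left (hcon a (by linarith)).le ENNReal.toReal_nonneg
  obtain ⟨a, ha⟩ : ∃ a, (π s a).toReal ≠ 0 := by
    by_contra! h0
    simp [h0] at hsum
  have hlt : (π s a).toReal * (M.r s a + M.expNext s a (M.bias π)) <
      (π s a).toReal * (M.optGain s + M.bias π s) := by
    have := (mul_eq_zero.1 (hzero a)).resolve_left ha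
    exact mul_lt_mul_of_pos_left (hcon a (by linarith))
      (lt_of_le_of_ne ENNReal.toReal_nonneg (Ne.symm ha))
  exact absurd (Finset.sum_lt_sum (fun a _ => hle a) ⟨a, Finset.mem_univ a, hlt⟩) hge.not_gt

end Blackwell

/-! ### Gain-dropping time and its potential -/

section GainDropping

open scoped ENNReal

variable {S A : Type*} [Fintype S] [MeasurableSpace S] [DiscreteMeasurableSpace S]
  [Fintype A] [MeasurableSpace A] [DiscreteMeasurableSpace A]

/-- The MDP with the transitions of `M` in which exactly the gain-dropping actions are rewarded. -/
noncomputable def dropMDP (M : MDP S A) : MDP S A where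
  P := M.P
  r s a := M.gainDropping.indicator (fun _ => 1) (s, a)
  r_mem s a := by
    by_cases h : (s, a) ∈ M.gainDropping <;> simp [h]

theorem dropMDP_r_of_lt {M : MDP S A} {s : S} {a : A}
    (h : M.expNext s a M.optGain < M.optGain s) : M.dropMDP.r s a = 1 := by
  have h' : (s, a) ∈ M.gainDropping := h
  simp [dropMDP, h']

theorem policyDropTime_eq (M : MDP S A) (π : Policy S A) :
    M.policyDropTime π = ⨆ s : S, ∑' t : ℕ,
      ENNReal.ofReal ((M.transOp π ^ t) (M.dropMDP.policyReward π) s) := by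
  unfold policyDropTime
  congr 1 with s
  have hmeas : ∀ t : ℕ, Measurable fun ω : ℕ → S × A =>
      M.gainDropping.indicator (fun _ => (1 : ℝ≥0∞)) (ω t) := fun t =>
    (Measurable.of_discrete (f := M.gainDropping.indicator fun _ => (1 : ℝ≥0∞))).comp
      (measurable_pi_apply t)
  rw [lintegral_tsum fun t => (hmeas t).aemeasurable]
  refine tsum_congr fun t => ?_
  have h1 := M.integral_coord π s (M.gainDropping.indicator fun _ => (1 : ℝ)) t
  have h2 : policyAvg π (M.gainDropping.indicator fun _ => (1 : ℝ)) =
      M.dropMDP.policyReward π := rfl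
  rw [← h2, ← h1, ofReal_integral_eq_lintegral_ofReal (M.integrable_coord π s _ t)
    (Eventually.of_forall fun ω => Set.indicator_nonneg (fun _ _ => zero_le_one) _)]
  refine lintegral_congr fun ω => ?_
  by_cases h : ω t ∈ M.gainDropping <;> simp [h]

/-- There are finitely many gain-dropping pairs, so their positive losses have a positive minimum.
-/
theorem exists_drop_gap (M : MDP S A) (hρ : ∀ s a, M.expNext s a M.optGain ≤ M.optGain s) :
    ∃ δ : ℝ, 0 < δ ∧ ∀ s a, δ * M.dropMDP.r s a ≤ M.optGain s - M.expNext s a M.optGain := by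
  set φ : S × A → ℝ := fun x => M.optGain x.1 - M.expNext x.1 x.2 M.optGain with hφ
  obtain ⟨δ, hδ, h⟩ : ∃ δ : ℝ, 0 < δ ∧ ∀ x ∈ M.gainDropping, δ ≤ φ x := by
    rcases M.gainDropping.eq_empty_or_nonempty with he | hne
    · exact ⟨1, one_pos, fun x hx => absurd hx (he ▸ Set.notMem_empty x)⟩
    · obtain ⟨x, hx, hmin⟩ := Set.exists_min_image M.gainDropping φ M.gainDropping.toFinite hne
      have hx' : M.expNext x.1 x.2 M.optGain < M.optGain x.1 := hx
      exact ⟨φ x, sub_pos.2 hx', hmin⟩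
  refine ⟨δ, hδ, fun s a => ?_⟩
  rcases (hρ s a).lt_or_eq with hlt | heq
  · rw [dropMDP_r_of_lt hlt, mul_one]
    exact h (s, a) hlt
  · have hx : (s, a) ∉ M.gainDropping := fun hx : M.expNext s a _ < _ => hx.ne heq
    have h0 : M.dropMDP.r s a = 0 := by simp [dropMDP, hx]
    rw [h0, mul_zero, heq, sub_self]

theorem sum_drop_le (M : MDP S A) {δ : ℝ} {d : S → A}
    (hd : ∀ s, δ * M.dropMDP.r s (d s) ≤ M.optGain s - M.expNext s (d s) M.optGain)
    (s : S) (T : ℕ) :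
    δ * ∑ t ∈ Finset.range T, (M.transOp (detPolicy d) ^ t)
      (M.dropMDP.policyReward (detPolicy d)) s ≤
        M.optGain s - (M.transOp (detPolicy d) ^ T) M.optGain s := by
  have h1 := congrFun (IsMarkovOp.sum_pow_sub (M.transOp (detPolicy d)) M.optGain T) s
  simp only [Finset.sum_apply, Pi.sub_apply] at h1
  rw [← h1, Finset.mul_sum]
  refine Finset.sum_le_sum fun t _ => ?_
  have h2 := ((M.isMarkovOp_transOp (detPolicy d)).pow t).mono
    (f := δ • M.dropMDP.policyReward (detPolicy d))
    (g := M.optGain - M.transOp (detPolicy d) M.optGain) (fun s => by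
      simp only [Pi.smul_apply, Pi.sub_apply, smul_eq_mul, policyReward_detPolicy,
        transOp_detPolicy]
      exact hd s) s
  rwa [map_smul, Pi.smul_apply, smul_eq_mul] at h2

/-- Each drop costs at least `δ` of the bounded vector `ρ`, so expected drops are at most `2 C / δ`.
Finiteness is essential: `toReal` would send an infinite drop time to `0`. -/
theorem iSup_policyDropTime_ne_top (M : MDP S A)
    (hρ : ∀ s a, M.expNext s a M.optGain ≤ M.optGain s) :
    (⨆ d : S → A, M.policyDropTime (detPolicy d)) ≠ ∞ := by
  obtain ⟨δ, hδ, hgap⟩ := M.exists_drop_gap hρ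
  obtain ⟨C, hC0, hC⟩ := exists_abs_le M.optGain
  refine ne_top_of_le_ne_top (ENNReal.ofReal_ne_top (r := 2 * C / δ)) (iSup_le fun d => ?_)
  rw [policyDropTime_eq]
  refine iSup_le fun s => ENNReal.tsum_le_of_sum_range_le fun T => ?_
  have hP := M.isMarkovOp_transOp (detPolicy d)
  rw [← ENNReal.ofReal_sum_of_nonneg fun t _ =>
    (hP.pow t).nonneg _ (M.dropMDP.policyReward_nonneg _) s]
  refine ENNReal.ofReal_le_ofReal ?_
  rw [le_div_iff₀' hδ]
  have h1 := M.sum_drop_le (fun s => hgap s (d s)) s T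
  have h2 := abs_le.1 (hC s)
  have h3 := abs_le.1 ((hP.pow T).abs_apply_le hC s)
  linarith [h2.2, h3.1]

theorem dropTime_nonneg (M : MDP S A) : 0 ≤ M.dropTime := ENNReal.toReal_nonneg

theorem sum_drop_le_dropTime (M : MDP S A)
    (hρ : ∀ s a, M.expNext s a M.optGain ≤ M.optGain s) (d : S → A) (s : S) (T : ℕ) :
    ∑ t ∈ Finset.range T, (M.transOp (detPolicy d) ^ t)
      (M.dropMDP.policyReward (detPolicy d)) s ≤ M.dropTime := by
  rw [dropTime, ← ENNReal.ofReal_le_iff_le_toReal (M.iSup_policyDropTime_ne_top hρ),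
    ENNReal.ofReal_sum_of_nonneg fun t _ => ((M.isMarkovOp_transOp _).pow t).nonneg _
      (M.dropMDP.policyReward_nonneg _) s]
  refine le_trans ?_ (le_iSup (fun d : S → A => M.policyDropTime (detPolicy d)) d)
  rw [policyDropTime_eq]
  refine le_trans ?_ (le_iSup _ s)
  exact ENNReal.sum_le_tsum _

variable [Nonempty A]

/-- The optimal discounted drop count is controlled by a greedy deterministic policy, hence by the
undiscounted count defining `dropTime`. -/
theorem dropMDP_bellman_fixed_mem (M : MDP S A)
    (hρ : ∀ s a, M.expNext s a M.optGain ≤ M.optGain s) {γ : ℝ} (hγ0 : 0 ≤ γ) (hγ1 : γ < 1)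
    {v : S → ℝ} (hv : M.dropMDP.bellman γ v = v) (s : S) : 0 ≤ v s ∧ v s ≤ M.dropTime := by
  constructor
  · refine M.dropMDP.le_bellman_fixed hγ0 hγ1 hv (U := 0) (fun s => ?_) s
    refine ⟨Classical.arbitrary A, ?_⟩
    have h1 : M.dropMDP.expNext s (Classical.arbitrary A) 0 = 0 := M.dropMDP.expNext_const _ _ 0
    rw [h1, mul_zero, add_zero]
    exact (M.dropMDP.r_mem _ _).1
  · obtain ⟨d, hd⟩ := M.dropMDP.exists_greedy γ v
    rw [hv] at hd
    have hP := M.isMarkovOp_transOp (detPolicy d)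
    refine (hP.le_discounted hγ0 hγ1 (f := M.dropMDP.policyReward (detPolicy d))
      (fun s => ?_) s).trans ?_
    · rw [policyReward_detPolicy, transOp_detPolicy]
      exact (hd s).le
    · have hnn : ∀ t : ℕ, 0 ≤ (M.transOp (detPolicy d) ^ t)
          (M.dropMDP.policyReward (detPolicy d)) s := fun t =>
        (hP.pow t).nonneg _ (M.dropMDP.policyReward_nonneg _) s
      refine Real.tsum_le_of_sum_range_le (fun t => mul_nonneg (pow_nonneg hγ0 t) (hnn t))
        fun T => le_trans (Finset.sum_le_sum fun t _ => ?_) (M.sum_drop_le_dropTime hρ d s T)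
      exact mul_le_of_le_one_left (hnn t) (pow_le_one₀ hγ0 hγ1.le)

/-- A potential certifying that no policy, stationary or not, takes more than `T_drop`
gain-dropping actions in expectation. -/
theorem exists_drop_potential (M : MDP S A)
    (hρ : ∀ s a, M.expNext s a M.optGain ≤ M.optGain s) :
    ∃ G : S → ℝ, (∀ s, 0 ≤ G s ∧ G s ≤ M.dropTime) ∧
      ∀ s a, M.dropMDP.r s a + M.expNext s a G ≤ G s := by
  set γ : ℕ → ℝ := fun k => 1 - 1 / ((k : ℝ) + 1) with hγ
  have hγ1 : ∀ k, γ k < 1 := fun k => by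
    have : 0 < 1 / ((k : ℝ) + 1) := by positivity
    simp only [hγ]
    linarith
  have hγ0 : ∀ k, 0 ≤ γ k := fun k => by
    have : 1 / ((k : ℝ) + 1) ≤ 1 := by
      rw [div_le_one (by positivity)]
      have : (0 : ℝ) ≤ k := by positivity
      linarith
    simp only [hγ]
    linarith
  choose v hv using fun k => M.dropMDP.exists_bellman_fixed (hγ0 k) (hγ1 k)
  have hmem : ∀ k, v k ∈ Set.Icc (0 : S → ℝ) (fun _ => M.dropTime) := fun k =>
    ⟨fun s => (M.dropMDP_bellman_fixed_mem hρ (hγ0 k) (hγ1 k) (hv k) s).1,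
      fun s => (M.dropMDP_bellman_fixed_mem hρ (hγ0 k) (hγ1 k) (hv k) s).2⟩
  -- The uniform bound by `dropTime` gives compactness; a subsequential limit as the discount tends
  -- to `1` inherits the Bellman inequality.
  obtain ⟨G, hG, φ, hφ, hlim⟩ := isCompact_Icc.tendsto_subseq hmem
  have hγlim : Tendsto (γ ∘ φ) atTop (𝓝 1) := by
    have := (tendsto_one_div_add_atTop_nhds_zero_nat (𝕜 := ℝ)).const_sub 1
    rw [sub_zero] at this
    exact this.comp hφ.tendsto_atTop
  have hlim' : ∀ s, Tendsto (fun k => v (φ k) s) atTop (𝓝 (G s)) := fun s =>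
    (tendsto_pi_nhds.1 hlim) s
  refine ⟨G, fun s => ⟨hG.1 s, hG.2 s⟩, fun s a => ?_⟩
  have h1 : Tendsto (fun k => M.expNext s a (v (φ k))) atTop (𝓝 (M.expNext s a G)) :=
    tendsto_finsetSum _ fun s' _ => (hlim' s').const_mul _
  have h2 := (hγlim.mul h1).const_add (M.dropMDP.r s a)
  rw [one_mul] at h2
  refine le_of_tendsto_of_tendsto' h2 (hlim' s) fun k => ?_
  have := M.dropMDP.le_bellman (γ (φ k)) (v (φ k)) s a
  rwa [hv] at this

end GainDropping

/-! ### Halpern iteration for nonexpansive maps -/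

section Halpern

variable {X : Type*} [NormedAddCommGroup X] [NormedSpace ℝ X] {L : X → X} {x₀ v : X} {γ : ℝ}

theorem halpernThenPicard_succ_of_lt {t : ℕ} (ht : t < halpernSteps γ) :
    halpernThenPicard x₀ γ L (t + 1) = (1 - halpernWeight (t + 1)) • x₀ +
      halpernWeight (t + 1) • L (halpernThenPicard x₀ γ L t) :=
  if_pos ht

theorem halpernThenPicard_succ_of_le {t : ℕ} (ht : halpernSteps γ ≤ t) :
    halpernThenPicard x₀ γ L (t + 1) = L (halpernThenPicard x₀ γ L t) :=
  if_neg ht.not_gt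

theorem halpernWeight_succ (t : ℕ) : halpernWeight (t + 1) = (t + 1) / ((t : ℝ) + 3) := by
  have : (t : ℝ) + 3 ≠ 0 := by positivity
  rw [halpernWeight]
  push_cast
  rw [show (t : ℝ) + 1 + 2 = t + 3 by ring]
  field_simp
  ring

theorem one_sub_halpernWeight_succ (t : ℕ) : 1 - halpernWeight (t + 1) = 2 / ((t : ℝ) + 3) := by
  rw [halpernWeight]
  push_cast
  rw [show (t : ℝ) + 1 + 2 = t + 3 by ring]
  ring

theorem norm_halpernThenPicard_sub_le (hL : ∀ x y, ‖L x - L y‖ ≤ ‖x - y‖) (hv : L v = v) (t : ℕ) :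
    ‖halpernThenPicard x₀ γ L t - v‖ ≤ ‖x₀ - v‖ := by
  induction t with
  | zero => exact le_rfl
  | succ t ih =>
    have h1 := (hL (halpernThenPicard x₀ γ L t) v).trans ih
    rw [hv] at h1
    rcases lt_or_ge t (halpernSteps γ) with ht | ht
    · rw [halpernThenPicard_succ_of_lt ht]
      have h2 : 0 ≤ 1 - halpernWeight (t + 1) := by
        rw [one_sub_halpernWeight_succ]
        positivity
      have h3 : 0 ≤ halpernWeight (t + 1) := by
        rw [halpernWeight_succ]
        positivity
      have h4 := (convex_closedBall v ‖x₀ - v‖) (x := x₀) (by simp [dist_eq_norm])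
        (y := L (halpernThenPicard x₀ γ L t)) (by simpa [dist_eq_norm] using h1) h2 h3 (by ring)
      simpa [dist_eq_norm] using h4
    · rwa [halpernThenPicard_succ_of_le ht]

/-- The image of an iterate and the anchor both lie in the ball of radius `‖x₀ - v‖` around the
fixed point. -/
theorem norm_map_halpernThenPicard_sub_le (hL : ∀ x y, ‖L x - L y‖ ≤ ‖x - y‖) (hv : L v = v)
    (t : ℕ) : ‖L (halpernThenPicard x₀ γ L t) - x₀‖ ≤ 2 * ‖x₀ - v‖ := by
  have h1 := (hL (halpernThenPicard x₀ γ L t) v).trans (norm_halpernThenPicard_sub_le hL hv t)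
  rw [hv] at h1
  calc ‖L (halpernThenPicard x₀ γ L t) - x₀‖
      = ‖(L (halpernThenPicard x₀ γ L t) - v) - (x₀ - v)‖ := by congr 1; abel
    _ ≤ ‖L (halpernThenPicard x₀ γ L t) - v‖ + ‖x₀ - v‖ := norm_sub_le _ _
    _ ≤ 2 * ‖x₀ - v‖ := by linarith

theorem norm_halpernThenPicard_succ_sub_le (hL : ∀ x y, ‖L x - L y‖ ≤ ‖x - y‖) (hv : L v = v)
    {t : ℕ} (ht : t < halpernSteps γ) :
    ‖halpernThenPicard x₀ γ L (t + 1) - halpernThenPicard x₀ γ L t‖ ≤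
      4 * ‖x₀ - v‖ / (t + 3) := by
  set D := ‖x₀ - v‖
  have hD0 : 0 ≤ D := norm_nonneg _
  induction t with
  | zero =>
    have h1 := norm_map_halpernThenPicard_sub_le (x₀ := x₀) (γ := γ) hL hv 0
    have h2 : halpernThenPicard x₀ γ L (0 + 1) - halpernThenPicard x₀ γ L 0 =
        halpernWeight (0 + 1) • (L (halpernThenPicard x₀ γ L 0) - x₀) := by
      rw [halpernThenPicard_succ_of_lt ht]
      change _ - x₀ = _
      module
    rw [h2, norm_smul, halpernWeight_succ, Real.norm_eq_abs, abs_of_nonneg (by positivity)]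
    norm_num
    linarith
  | succ t ih =>
    have ht' : t < halpernSteps γ := by omega
    have h1 := norm_map_halpernThenPicard_sub_le (x₀ := x₀) (γ := γ) hL hv (t + 1)
    -- The increment splits into a damped copy of the previous one and the effect of changing the
    -- anchor weight. The weights make `4 D / (t + 3)` close under this recursion.
    have h2 : halpernThenPicard x₀ γ L (t + 1 + 1) - halpernThenPicard x₀ γ L (t + 1) =
        halpernWeight (t + 1) •
          (L (halpernThenPicard x₀ γ L (t + 1)) - L (halpernThenPicard x₀ γ L t)) +
        (halpernWeight (t + 1 + 1) - halpernWeight (t + 1)) •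
          (L (halpernThenPicard x₀ γ L (t + 1)) - x₀) := by
      refine (congrArg₂ (· - ·) (halpernThenPicard_succ_of_lt ht)
        (halpernThenPicard_succ_of_lt ht')).trans ?_
      module
    have h3 := (hL (halpernThenPicard x₀ γ L (t + 1)) (halpernThenPicard x₀ γ L t)).trans (ih ht')
    have hw : halpernWeight (t + 1 + 1) - halpernWeight (t + 1) =
        2 / (((t : ℝ) + 3) * (t + 4)) := by
      rw [halpernWeight_succ, halpernWeight_succ]
      push_cast
      field_simp
      ring
    rw [h2]
    refine (norm_add_le _ _).trans ?_
    rw [norm_smul, norm_smul, hw, halpernWeight_succ, Real.norm_eq_abs, Real.norm_eq_abs,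
      abs_of_nonneg (by positivity), abs_of_nonneg (by positivity)]
    refine (add_le_add (mul_le_mul_of_nonneg_left h3 (by positivity))
      (mul_le_mul_of_nonneg_left h1 (by positivity))).trans ?_
    push_cast
    rw [← sub_nonneg]
    have hkey : 4 * D / ((t : ℝ) + 1 + 3) - ((t + 1) / ((t : ℝ) + 3) * (4 * D / (t + 3)) +
        2 / (((t : ℝ) + 3) * (t + 4)) * (2 * D)) = 8 * D / ((t + 3) ^ 2 * (t + 4)) := by
      rw [show (t : ℝ) + 1 + 3 = t + 4 by ring]
      field_simp
      ring
    rw [hkey]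
    positivity

/-- The fixed-point residual of the Halpern iterates. -/
theorem norm_halpernThenPicard_residual_le (hL : ∀ x y, ‖L x - L y‖ ≤ ‖x - y‖) (hv : L v = v)
    {t : ℕ} (ht : t < halpernSteps γ) :
    ‖L (halpernThenPicard x₀ γ L (t + 1)) - halpernThenPicard x₀ γ L (t + 1)‖ ≤
      8 * ‖x₀ - v‖ / (t + 3) := by
  have h1 := norm_map_halpernThenPicard_sub_le (x₀ := x₀) (γ := γ) hL hv t
  have h2 := (hL (halpernThenPicard x₀ γ L (t + 1)) (halpernThenPicard x₀ γ L t)).trans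
    (norm_halpernThenPicard_succ_sub_le hL hv ht)
  have h3 : L (halpernThenPicard x₀ γ L (t + 1)) - halpernThenPicard x₀ γ L (t + 1) =
      (L (halpernThenPicard x₀ γ L (t + 1)) - L (halpernThenPicard x₀ γ L t)) +
      (1 - halpernWeight (t + 1)) • (L (halpernThenPicard x₀ γ L t) - x₀) := by
    nth_rw 2 [halpernThenPicard_succ_of_lt ht]
    module
  rw [h3]
  refine (norm_add_le _ _).trans ?_
  rw [norm_smul, one_sub_halpernWeight_succ, Real.norm_eq_abs, abs_of_nonneg (by positivity)]
  refine (add_le_add h2 (mul_le_mul_of_nonneg_left h1 (by positivity))).trans_eq ?_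
  ring

end Halpern

/-! ### Warm start and discounted fixed point near `n ρ` -/

section WarmStart

variable {S A : Type*} [Fintype S] [Fintype A] [Nonempty A]

theorem iterate_bellman_le (M : MDP S A) {ρ h : S → ℝ} (hρ : ∀ s a, M.expNext s a ρ ≤ ρ s)
    (h0 : ∀ s, 0 ≤ h s) (hh : ∀ s a, M.r s a + M.expNext s a h ≤ ρ s + h s) (k : ℕ) (s : S) :
    (M.bellman 1)^[k] 0 s ≤ k * ρ s + h s := by
  induction k generalizing s with
  | zero => simpa using h0 s
  | succ k ih =>
    rw [Function.iterate_succ_apply']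
    refine M.bellman_le fun a => ?_
    have h1 := M.expNext_mono s a ih
    rw [expNext_add, expNext_mul] at h1
    have h2 := mul_le_mul_of_nonneg_left (hρ s a) (Nat.cast_nonneg (α := ℝ) k)
    have h3 := hh s a
    push_cast
    linarith

/-- The action must preserve `ρ`: the accumulated term `k ρ` then passes through the transition
without loss. -/
theorem le_iterate_bellman (M : MDP S A) {ρ h : S → ℝ} (h0 : ∀ s, h s ≤ 0)
    (hh : ∀ s, ∃ a, M.expNext s a ρ = ρ s ∧ ρ s + h s ≤ M.r s a + M.expNext s a h)
    (k : ℕ) (s : S) : k * ρ s + h s ≤ (M.bellman 1)^[k] 0 s := by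
  induction k generalizing s with
  | zero => simpa using h0 s
  | succ k ih =>
    rw [Function.iterate_succ_apply']
    obtain ⟨a, ha, hr⟩ := hh s
    refine le_trans ?_ (M.le_bellman 1 _ s a)
    have h1 := M.expNext_mono s a ih
    rw [expNext_add, expNext_mul, ha] at h1
    push_cast
    linarith

variable {n : ℕ}

theorem bellman_fixed_le_gain_add (M : MDP S A) (hn : 2 ≤ n) {ρ h v : S → ℝ}
    (hv : M.bellman (1 - 1 / (n : ℝ)) v = v) (hρ : ∀ s a, M.expNext s a ρ ≤ ρ s)
    (h0 : ∀ s, 0 ≤ h s) (hh : ∀ s a, M.r s a + M.expNext s a h ≤ ρ s + h s) (s : S) :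
    v s ≤ n * ρ s + h s := by
  have hn' : (2 : ℝ) ≤ n := by exact_mod_cast hn
  have hinv : 0 < 1 / (n : ℝ) := by positivity
  have hinv1 : 1 / (n : ℝ) ≤ 1 := by
    rw [div_le_one (by positivity)]
    linarith
  refine M.bellman_fixed_le (by linarith) (by linarith) hv (U := fun s => n * ρ s + h s)
    (fun s a => ?_) s
  rw [expNext_add, expNext_mul, mul_add, ← mul_assoc,
    show (1 - 1 / (n : ℝ)) * n = n - 1 by field_simp]
  have h1 := mul_le_mul_of_nonneg_left (hρ s a) (by linarith : (0 : ℝ) ≤ n - 1)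
  have h2 := mul_nonneg hinv.le (M.le_expNext s a h0)
  have h3 := hh s a
  linarith

theorem gain_add_le_bellman_fixed (M : MDP S A) (hn : 2 ≤ n) {ρ h v : S → ℝ}
    (hv : M.bellman (1 - 1 / (n : ℝ)) v = v) (h0 : ∀ s, h s ≤ 0)
    (hh : ∀ s, ∃ a, M.expNext s a ρ = ρ s ∧ ρ s + h s ≤ M.r s a + M.expNext s a h) (s : S) :
    n * ρ s + h s ≤ v s := by
  have hn' : (2 : ℝ) ≤ n := by exact_mod_cast hn
  have hinv : 0 < 1 / (n : ℝ) := by positivity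
  have hinv1 : 1 / (n : ℝ) ≤ 1 := by
    rw [div_le_one (by positivity)]
    linarith
  refine M.le_bellman_fixed (by linarith) (by linarith) hv (U := fun s => n * ρ s + h s)
    (fun s => ?_) s
  obtain ⟨a, ha, hr⟩ := hh s
  refine ⟨a, ?_⟩
  rw [expNext_add, expNext_mul, mul_add, ← mul_assoc,
    show (1 - 1 / (n : ℝ)) * n = n - 1 by field_simp, ha]
  have h2 := mul_nonneg hinv.le (neg_nonneg.2 (M.expNext_le s a h0))
  linarith

/-- The vector returned by the algorithm is close to `n ρ` and nearly a fixed point. -/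
theorem warmStartVector_bounds (M : MDP S A) (hn : 2 ≤ n) {ρ hu hl : S → ℝ} {K : ℝ} (hK : 0 ≤ K)
    (hρ : ∀ s a, M.expNext s a ρ ≤ ρ s)
    (hu0 : ∀ s, 0 ≤ hu s ∧ hu s ≤ K) (hl0 : ∀ s, -K ≤ hl s ∧ hl s ≤ 0)
    (hu_le : ∀ s a, M.r s a + M.expNext s a hu ≤ ρ s + hu s)
    (hl_le : ∀ s, ∃ a, M.expNext s a ρ = ρ s ∧ ρ s + hl s ≤ M.r s a + M.expNext s a hl) (s : S) :
    |M.warmStartVector (1 - 1 / (n : ℝ)) (2 * n) s - n * ρ s| ≤ 3 * K ∧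
      M.warmStartVector (1 - 1 / (n : ℝ)) (2 * n) s - 16 * K / (n + 1) ≤
        M.bellman (1 - 1 / (n : ℝ)) (M.warmStartVector (1 - 1 / (n : ℝ)) (2 * n)) s := by
  have hn' : (2 : ℝ) ≤ n := by exact_mod_cast hn
  have hinv : 0 < 1 / (n : ℝ) := by positivity
  have hinv1 : 1 / (n : ℝ) ≤ 1 := by
    rw [div_le_one (by positivity)]
    linarith
  have hfloor : ⌊1 / (1 - (1 - 1 / (n : ℝ)))⌋₊ = n := by
    rw [sub_sub_cancel, one_div_one_div, Nat.floor_natCast]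
  set γ : ℝ := 1 - 1 / (n : ℝ) with hγ
  have hγ0 : 0 ≤ γ := by linarith
  have hsteps : halpernSteps γ = n - 1 := by rw [halpernSteps, hfloor]
  obtain ⟨v, hv⟩ := M.exists_bellman_fixed hγ0 (by linarith)
  set L := M.bellman γ
  set x₀ := (M.bellman 1)^[n] 0
  have hL : ∀ x y, ‖L x - L y‖ ≤ ‖x - y‖ := fun x y =>
    (M.norm_bellman_sub_le hγ0 x y).trans
      (mul_le_of_le_one_left (norm_nonneg _) (by linarith))
  have hv1 := M.bellman_fixed_le_gain_add hn hv hρ (fun s => (hu0 s).1) hu_le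
  have hv2 := M.gain_add_le_bellman_fixed hn hv (fun s => (hl0 s).2) hl_le
  have hD : ‖x₀ - v‖ ≤ 2 * K := by
    rw [pi_norm_le_iff_of_nonneg (by positivity)]
    intro s
    have h1 := M.iterate_bellman_le hρ (fun s => (hu0 s).1) hu_le n s
    have h2 := M.le_iterate_bellman (fun s => (hl0 s).2) hl_le n s
    have h3 := hv1 s
    have h4 := hv2 s
    have h5 := (hu0 s).2
    have h6 := (hl0 s).1
    rw [Pi.sub_apply, Real.norm_eq_abs, abs_le]
    constructor <;> linarith
  -- The last of the `n - 1` Halpern steps has index `m = n - 2`; the one remaining iteration is a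
  -- Picard step.
  obtain ⟨m, rfl⟩ : ∃ m, n = m + 2 := ⟨n - 2, by omega⟩
  have hV : M.warmStartVector γ (2 * (m + 2)) = L (halpernThenPicard x₀ γ L (m + 1)) := by
    rw [warmStartVector, hfloor, show 2 * (m + 2) - (m + 2) = m + 1 + 1 by omega]
    exact halpernThenPicard_succ_of_le (by omega)
  have hy := norm_halpernThenPicard_sub_le (x₀ := x₀) (γ := γ) hL hv (m + 1)
  have hres := norm_halpernThenPicard_residual_le (x₀ := x₀) (γ := γ) hL hv (t := m) (by omega)
  set y := halpernThenPicard x₀ γ L (m + 1)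
  rw [hV]
  constructor
  · have h1 := (hL y v).trans (hy.trans hD)
    rw [hv] at h1
    have h2 := abs_le.1 ((norm_le_pi_norm (L y - v) s).trans h1)
    rw [Pi.sub_apply] at h2
    have h3 := hv1 s
    have h4 := hv2 s
    have h5 := (hu0 s).2
    have h6 := (hl0 s).1
    rw [abs_le]
    constructor <;> linarith
  · have h1 := (hL (L y) y).trans hres
    have h2 := abs_le.1 ((norm_le_pi_norm (L (L y) - L y) s).trans h1)
    rw [Pi.sub_apply] at h2
    have h3 : 8 * ‖x₀ - v‖ / ((m : ℝ) + 3) ≤ 16 * K / (((m + 2 : ℕ) : ℝ) + 1) := by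
      push_cast
      rw [show (m : ℝ) + 2 + 1 = m + 3 by ring]
      exact div_le_div_of_nonneg_right (by linarith) (by positivity)
    linarith [h2.1]

end WarmStart

theorem exists_span_bounds {S : Type*} [Fintype S] [Nonempty S] (h : S → ℝ) :
    ∃ lo hi, MDP.span h = hi - lo ∧ ∀ s, lo ≤ h s ∧ h s ≤ hi :=
  ⟨_, _, rfl, fun s =>
    ⟨Finset.inf'_le _ (Finset.mem_univ s), Finset.le_sup' _ (Finset.mem_univ s)⟩⟩

/-! ### From an approximate fixed point to the gain of the greedy policy -/

section SuboptimalityBound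

variable {S A : Type*} [Fintype S] [MeasurableSpace S] [DiscreteMeasurableSpace S]
  [Fintype A] [MeasurableSpace A] [DiscreteMeasurableSpace A]

theorem gain_nonneg (M : MDP S A) (π : Policy S A) (s : S) : 0 ≤ M.gain π s :=
  ge_of_tendsto' (M.tendsto_sum_gain π s) fun T => by
    refine mul_nonneg (by positivity) (Finset.sum_nonneg fun t _ => ?_)
    exact ((M.isMarkovOp_transOp π).pow t).nonneg _ (M.policyReward_nonneg π) s

/-- A reward that dominates `ρ - ε` up to a coboundary yields a gain of at least `ρ - ε` minus
the loss of `ρ` along the chain. -/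
theorem le_gain_of_le_reward (M : MDP S A) (π : Policy S A) {ρ V : S → ℝ} {ε B : ℝ}
    (hr : ∀ s, ρ s - ε + (V s - M.transOp π V s) ≤ M.policyReward π s) {s : S}
    (hB : ∀ t : ℕ, ρ s - (M.transOp π ^ t) ρ s ≤ B) : ρ s - B - ε ≤ M.gain π s := by
  have hP := M.isMarkovOp_transOp π
  have hfix : M.transOp π (M.gain π) = M.gain π := funext (M.transOp_gain π)
  -- Subtracting a coboundary from the reward leaves its Cesàro limit unchanged, so the gain can be
  -- read from a function that dominates `ρ - ε`.
  have hlim := hP.tendsto_cesaro (f := M.policyReward π - (V - M.transOp π V))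
    (w := M.bias π - V) hfix (by
      ext s
      simp only [map_sub, Pi.add_apply, Pi.sub_apply]
      linarith [M.policyReward_eq π s]) s
  refine ge_of_tendsto hlim ?_
  filter_upwards [eventually_gt_atTop 0] with T hT
  have hT' : (0 : ℝ) < T := by exact_mod_cast hT
  have hsum : (T : ℝ) * (ρ s - B - ε) ≤
      ∑ t ∈ Finset.range T, (M.transOp π ^ t) (M.policyReward π - (V - M.transOp π V)) s := by
    have hcard : (T : ℝ) * (ρ s - B - ε) = ∑ _t ∈ Finset.range T, (ρ s - B - ε) := by
      rw [Finset.sum_const, Finset.card_range, nsmul_eq_mul]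
    rw [hcard]
    refine Finset.sum_le_sum fun t _ => ?_
    have h1 := (hP.pow t).mono (f := ρ - fun _ => ε)
      (g := M.policyReward π - (V - M.transOp π V)) (fun s => by
        simp only [Pi.sub_apply]
        linarith [hr s]) s
    rw [map_sub, (hP.pow t).map_const, Pi.sub_apply] at h1
    linarith [hB t]
  rw [one_div, ← div_eq_inv_mul, le_div_iff₀ hT']
  linarith

/-- The loss of `ρ` telescopes into one-step losses, which vanish off gain-dropping pairs and are at
most `δ` on them. -/
theorem optGain_sub_pow_le (M : MDP S A)
    (hρ : ∀ s a, M.expNext s a M.optGain ≤ M.optGain s) {d : S → A} {δ : ℝ} (hδ : 0 ≤ δ)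
    (hd : ∀ s, M.optGain s - M.expNext s (d s) M.optGain ≤ δ) (s : S) (T : ℕ) :
    M.optGain s - (M.transOp (detPolicy d) ^ T) M.optGain s ≤ δ * M.dropTime := by
  have h1 := congrFun (IsMarkovOp.sum_pow_sub (M.transOp (detPolicy d)) M.optGain T) s
  simp only [Finset.sum_apply, Pi.sub_apply] at h1
  rw [← h1]
  refine le_trans ?_ (mul_le_mul_of_nonneg_left (M.sum_drop_le_dropTime hρ d s T) hδ)
  rw [Finset.mul_sum]
  refine Finset.sum_le_sum fun t _ => ?_
  have h2 := ((M.isMarkovOp_transOp (detPolicy d)).pow t).mono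
    (f := M.optGain - M.transOp (detPolicy d) M.optGain)
    (g := δ • M.dropMDP.policyReward (detPolicy d)) (fun s => by
      simp only [Pi.smul_apply, Pi.sub_apply, smul_eq_mul, policyReward_detPolicy,
        transOp_detPolicy]
      rcases (hρ s (d s)).lt_or_eq with h | h
      · rw [dropMDP_r_of_lt h, mul_one]
        exact hd s
      · rw [h, sub_self]
        exact mul_nonneg hδ (M.dropMDP.r_mem _ _).1) s
  rwa [map_smul, Pi.smul_apply, smul_eq_mul] at h2

variable [Nonempty A]

/-- The suboptimality of the output policy in terms of any vectors that certify upper and lower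
bounds for value iteration. -/
theorem optGain_sub_gain_le (M : MDP S A) {n : ℕ} (hn : 2 ≤ n) {hu hl : S → ℝ} {K : ℝ}
    (hK : 0 ≤ K) (hρ : ∀ s a, M.expNext s a M.optGain ≤ M.optGain s)
    (hu0 : ∀ s, 0 ≤ hu s ∧ hu s ≤ K) (hl0 : ∀ s, -K ≤ hl s ∧ hl s ≤ 0)
    (hu_le : ∀ s a, M.r s a + M.expNext s a hu ≤ M.optGain s + hu s)
    (hl_le : ∀ s, ∃ a, M.expNext s a M.optGain = M.optGain s ∧
      M.optGain s + hl s ≤ M.r s a + M.expNext s a hl)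
    {d : S → A} (hd : M.IsWarmStartOutput (1 - 1 / (n : ℝ)) (2 * n) d) (s : S) :
    M.optGain s - M.gain (detPolicy d) s ≤
      (M.dropTime + 1) * ((71 * K + 2) / ((n : ℝ) - 1)) := by
  have hn' : (2 : ℝ) ≤ n := by exact_mod_cast hn
  have hinv : 0 < 1 / (n : ℝ) := by positivity
  have hinv1 : 1 / (n : ℝ) ≤ 1 := by
    rw [div_le_one (by positivity)]
    linarith
  have hn1 : (0 : ℝ) < n - 1 := by linarith
  have hbd := M.warmStartVector_bounds hn hK hρ hu0 hl0 hu_le hl_le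
  unfold IsWarmStartOutput at hd
  set V := M.warmStartVector (1 - 1 / (n : ℝ)) (2 * n)
  have hγn : (1 - 1 / (n : ℝ)) * n = n - 1 := by field_simp
  set γ : ℝ := 1 - 1 / (n : ℝ) with hγ
  have hγ0 : 0 ≤ γ := by linarith
  have hVu : ∀ s, V s ≤ n * M.optGain s + 3 * K := fun s => by
    linarith [(abs_le.1 (hbd s).1).2]
  have hVl : ∀ s, n * M.optGain s + -(3 * K) ≤ V s := fun s => by
    linarith [(abs_le.1 (hbd s).1).1]
  -- Compare the greedy action with a gain-preserving one: the two errors of `3 K` and the reward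
  -- range `1` bound `(n - 1)` times the loss of `ρ`.
  have hdrop : ∀ s, M.optGain s - M.expNext s (d s) M.optGain ≤ (1 + 6 * K) / (n - 1) := by
    intro s
    obtain ⟨a, ha, -⟩ := hl_le s
    rw [le_div_iff₀' hn1, ← hγn]
    have h1 := M.expNext_mono s (d s) hVu
    have h2 := M.expNext_mono s a hVl
    rw [expNext_add, expNext_mul, expNext_const] at h1 h2
    rw [ha] at h2
    have h3 := mul_le_mul_of_nonneg_left h1 hγ0
    have h4 := mul_le_mul_of_nonneg_left h2 hγ0
    have h5 := (M.r_mem s (d s)).2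
    have h6 := (M.r_mem s a).1
    have h7 := hd s a
    have h8 := mul_nonneg hinv.le hK
    nlinarith
  -- Using `γ V` as the potential leaves `V / n`, which is at least `ρ - 3 K / n`; the residual
  -- contributes the other `16 K`.
  have hrew : ∀ s, M.optGain s - 19 * K / (n - 1) +
      ((γ • V) s - M.transOp (detPolicy d) (γ • V) s) ≤ M.policyReward (detPolicy d) s := by
    intro s
    rw [map_smul]
    simp only [Pi.smul_apply, smul_eq_mul]
    rw [transOp_detPolicy, policyReward_detPolicy]
    have h1 : M.bellman γ V s ≤ _ := M.bellman_le (hd s)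
    have h2 := (hbd s).2
    have h3 := mul_le_mul_of_nonneg_left (hVl s) hinv.le
    have h4 : 1 / (n : ℝ) * (n * M.optGain s + -(3 * K)) = M.optGain s - 3 * K / n := by
      field_simp
      ring
    have h5 : 16 * K / ((n : ℝ) + 1) ≤ 16 * K / (n - 1) :=
      div_le_div_of_nonneg_left (by positivity) hn1 (by linarith)
    have h6 : 3 * K / (n : ℝ) ≤ 3 * K / (n - 1) :=
      div_le_div_of_nonneg_left (by positivity) hn1 (by linarith)
    have h7 : 19 * K / ((n : ℝ) - 1) = 16 * K / (n - 1) + 3 * K / (n - 1) := by ring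
    have h8 : γ * V s = V s - 1 / (n : ℝ) * V s := by
      rw [hγ]
      ring
    linarith
  have hT := M.dropTime_nonneg
  have hmain := M.le_gain_of_le_reward (detPolicy d) hrew
    fun t => M.optGain_sub_pow_le hρ (by positivity) hdrop s t
  have hfin : (1 + 6 * K) / ((n : ℝ) - 1) * M.dropTime + 19 * K / (n - 1) ≤
      (M.dropTime + 1) * ((71 * K + 2) / ((n : ℝ) - 1)) := by
    rw [div_mul_eq_mul_div, ← add_div, ← mul_div_assoc]
    gcongr
    -- The numerator is `(1 + 6 K) T_drop + 19 K`, so the constants `71` and `2` leave room.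
    nlinarith [mul_nonneg hT hK]
  linarith

end SuboptimalityBound

end MDP

theorem theorem8 {S A : Type*}
    [Fintype S] [Nonempty S] [MeasurableSpace S] [DiscreteMeasurableSpace S]
    [Fintype A] [Nonempty A] [MeasurableSpace A] [DiscreteMeasurableSpace A]
    (M : MDP S A) (n : ℕ) (hn : 2 ≤ n)
    (h : S → ℝ) (hmod : M.ModifiedBellman M.optGain h) (hunmod : M.UnmodifiedBellman M.optGain h)
    (πstar : MDP.Policy S A) (hstar : M.IsBlackwellOptimal πstar)
    (d : S → A) (hd : M.IsWarmStartOutput (1 - 1 / (n : ℝ)) (2 * n) d) :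
    ∀ s : S, M.optGain s - M.gain (MDP.detPolicy d) s ≤
      (M.dropTime + 1) *
        ((71 * min (MDP.span h)
            (MDP.span (M.bias πstar) + M.dropTime + MDP.span (M.bias πstar) * M.dropTime) + 2) /
          ((n : ℝ) - 1)) := by
  intro s
  have hρ : ∀ s a, M.expNext s a M.optGain ≤ M.optGain s := fun s a =>
    (hmod.1 s).2 ⟨a, rfl⟩
  have shift : ∀ (s : S) (a : A) (f : S → ℝ) (c : ℝ),
      M.expNext s a (fun s => f s - c) = M.expNext s a f - c := by
    intro s a f c
    rw [MDP.expNext_sub, MDP.expNext_const]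
  rcases min_choice (MDP.span h)
    (MDP.span (M.bias πstar) + M.dropTime + MDP.span (M.bias πstar) * M.dropTime) with hm | hm
  · rw [hm]
    obtain ⟨lo, hi, hspan, hb⟩ := MDP.exists_span_bounds h
    have hs := hb s
    refine M.optGain_sub_gain_le hn (hu := fun s => h s - lo) (hl := fun s => h s - hi)
      (by linarith) hρ (fun s => ?_) (fun s => ?_) (fun s a => ?_) (fun s => ?_) hd s
    · constructor <;> linarith [(hb s).1, (hb s).2]
    · constructor <;> linarith [(hb s).1, (hb s).2]
    · rw [shift]
      have := (hmod.2 s).2 ⟨a, rfl⟩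
      linarith
    · obtain ⟨a, ha, hr⟩ := (hunmod.2 s).1
      refine ⟨a, ha, ?_⟩
      rw [shift]
      linarith
  · rw [hm]
    set b := M.bias πstar
    obtain ⟨lo, hi, hspan, hb⟩ := MDP.exists_span_bounds b
    obtain ⟨G, hG, hGstep⟩ := M.exists_drop_potential hρ
    have hT := M.dropTime_nonneg
    have hs := hb s
    have hspan0 : 0 ≤ MDP.span b := by linarith
    have hprod := mul_nonneg hspan0 hT
    -- A gain-dropping action can violate the upper inequality for `b` by at most `1 + sp(b)`, since
    -- `r ≤ 1` and `ρ ≥ 0`; this is the multiple of `G` needed. The maximum of `hu` is then at most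
    -- `sp(b) + (1 + sp(b)) T_drop`, the second term of the minimum.
    refine M.optGain_sub_gain_le hn (hu := fun s => (b s - lo) + (1 + MDP.span b) * G s)
      (hl := fun s => b s - hi) (by linarith) hρ (fun s => ?_) (fun s => ?_) (fun s a => ?_)
      (fun s => ?_) hd s
    · have h1 := hb s
      have h2 := mul_nonneg (by linarith : 0 ≤ 1 + MDP.span b) (hG s).1
      have h3 := mul_le_mul_of_nonneg_left (hG s).2 (by linarith : 0 ≤ 1 + MDP.span b)
      constructor <;> linarith
    · constructor <;> linarith [(hb s).1, (hb s).2]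
    · rw [MDP.expNext_add, MDP.expNext_mul, shift]
      have h1 := mul_le_mul_of_nonneg_left (hGstep s a) (by linarith : 0 ≤ 1 + MDP.span b)
      rcases (hρ s a).lt_or_eq with hlt | heq
      · rw [MDP.dropMDP_r_of_lt hlt] at h1
        have h2 := M.expNext_le s a fun s => (hb s).2
        have h3 := (M.r_mem s a).2
        have h4 := M.gain_nonneg πstar s
        rw [← hstar.optGain_eq] at h4
        linarith [(hb s).1]
      · have h2 := hstar.reward_add_expNext_bias_le heq
        have h3 := mul_nonneg (by linarith : 0 ≤ 1 + MDP.span b) (M.dropMDP.r_mem s a).1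
        linarith
    · obtain ⟨a, ha, hr⟩ := hstar.exists_action hρ s
      refine ⟨a, ha, ?_⟩
      rw [shift]
      linarith
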